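/- Let $d\ge 2$ and let $\mathcal A$ be the quasi-local $C^*$-algebra of the quantum spin chain on $\mathbb Z$ with the algebra $M_d$ of complex $d\times d$ matrices at each site, that is, the $C^*$-inductive limit of the algebras $\bigotimes_{z\in\Lambda}M_d$ over the finite sets $\Lambda\subset\mathbb Z$. Let $\mathcal A_R,\mathcal A_L\subset\mathcal A$ be the subalgebras of the half-lines $[0,\infty)$ and $(-\infty,-1]$. Let $\gamma$ be the $*$-automorphism of $\mathcal A$ with $\gamma(Q^{(j)})=Q^{(-j-1)}$ for all $Q\in M_d$ and $j\in\mathbb Z$, where $Q^{(j)}$ is $Q$ placed at site $j$, and let $\gamma_{L\to R}:\mathcal A_L\to\mathcal A_R$ be its restriction. Let $\omega$ be a pure state on $\mathcal A$ such that $\omega\circ\gamma=\omega$ and such that $\omega$ has the split property: $\pi(\mathcal A_R)''$ is a type I factor, where $\pi$ is the GNS representation of $\omega|_{\mathcal A_R}$. Let $(\mathcal H_\omega,\pi_\omega,\Omega_\omega,\Gamma_\omega)$ be a reflection-split representation associated to $\omega$. This means that $(\mathcal H_\omega,\pi_\omega)$ is an irreducible representation of $\mathcal A_R$ on a Hilbert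 space, $\Omega_\omega$ is a unit vector of $\hat{\mathcal H}_\omega:=\mathcal H_\omega\otimes\mathcal H_\omega$, the triple $(\hat{\mathcal H}_\omega,\hat\pi_\omega,\Omega_\omega)$ with $\hat\pi_\omega:=(\pi_\omega\circ\gamma_{L\to R})\otimes\pi_\omega$ is a GNS triple of $\omega$, and $\Gamma_\omega$ is the unitary on $\hat{\mathcal H}_\omega$ with $\Gamma_\omega\hat\pi_\omega(A)\Omega_\omega=\hat\pi_\omega(\gamma(A))\Omega_\omega$ for $A\in\mathcal A$. Let $s_\omega$ be the projection in $B(\mathcal H_\omega)$ such that $\mathbb I\otimes s_\omega$ is the support projection of $\Omega_\omega$ in $\mathbb I\otimes B(\mathcal H_\omega)$, i.e. the least projection of this algebra that fixes $\Omega_\omega$. Put $p_\omega:=s_\omega\otimes s_\omega$ and $\mathcal M:=s_\omega\otimes B(s_\omega\mathcal H_\omega)$, a von Neumann algebra on $p_\omega\hat{\mathcal H}_\omega$. Let $J_\omega$ be the modular conjugation of $(\mathcal M,\Omega_\omega)$ on $p_\omega\hat{\mathcal H}_\omega$, i.e. the anti-unitary factor of the polar decomposition $S=J_\omega\Delta^{1/2}$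 of the closure $S$ of the operator $x\Omega_\omega\mapsto x^*\Omega_\omega$, $x\in\mathcal M$. Then: 1. There is an anti-unitary $\theta:s_\omega\mathcal H_\omega\to s_\omega\mathcal H_\omega$ such that $$J_\omega(s_\omega\otimes x)J_\omega^*=\theta x\theta^*\otimes s_\omega\qquad\text{for all }x\in B(s_\omega\mathcal H_\omega).\tag{$*$}$$ 2. Every anti-unitary $\theta:s_\omega\mathcal H_\omega\to s_\omega\mathcal H_\omega$ satisfying $(*)$ also satisfies $$J_\omega(x\otimes s_\omega)J_\omega^*=s_\omega\otimes\theta x\theta^*\qquad\text{for all }x\in B(s_\omega\mathcal H_\omega).$$ 3. There is a $\kappa_\omega\in\{1,-1\}$ such that $\theta^2=\kappa_\omega s_\omega$ for every anti-unitary $\theta:s_\omega\mathcal H_\omega\to s_\omega\mathcal H_\omega$ satisfying $(*)$. -/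

import Mathlib

noncomputable section

open scoped TensorProduct InnerProductSpace ComplexOrder

namespace SpinChain

universe u v

section Tensor

variable {E : Type u} {F : Type v} [NormedAddCommGroup E] [InnerProductSpace ℂ E]
  [NormedAddCommGroup F] [InnerProductSpace ℂ F]

theorem norm_rTensor_le (a : E →L[ℂ] E) (x : E ⊗[ℂ] F) :
    ‖(a : E →ₗ[ℂ] E).rTensor F x‖ ≤ ‖a‖ * ‖x‖ := by
  obtain ⟨F', hF', hx⟩ := TensorProduct.exists_finite_submodule_right_of_setFinite {x}
    (Set.finite_singleton x)
  obtain ⟨y, rfl⟩ : x ∈ LinearMap.range (F'.subtype.lTensor E) := hx rfl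
  have hfin : Module.Finite ℂ F' := hF'
  obtain ⟨c, rfl⟩ := TensorProduct.eq_repr_basis_right (stdOrthonormalBasis ℂ F').toBasis y
  have key : ∀ c : Fin (Module.finrank ℂ F') →₀ E,
      ‖F'.subtype.lTensor E (c.sum fun i m => m ⊗ₜ[ℂ] (stdOrthonormalBasis ℂ F').toBasis i)‖ ^ 2
        = ∑ i, ‖c i‖ ^ 2 := by
    intro c
    rw [Finsupp.sum_fintype _ _ (by simp), map_sum, ← inner_self_eq_norm_sq (𝕜 := ℂ), sum_inner]
    simp only [inner_sum, LinearMap.lTensor_tmul, TensorProduct.inner_tmul, Submodule.subtype_apply,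
      OrthonormalBasis.coe_toBasis, ← Submodule.coe_inner, OrthonormalBasis.inner_eq_ite]
    simp [← Complex.ofReal_pow]
  have h2 : (a : E →ₗ[ℂ] E).rTensor F
      (F'.subtype.lTensor E (c.sum fun i m => m ⊗ₜ[ℂ] (stdOrthonormalBasis ℂ F').toBasis i)) =
      F'.subtype.lTensor E ((c.mapRange a (map_zero a)).sum
        fun i m => m ⊗ₜ[ℂ] (stdOrthonormalBasis ℂ F').toBasis i) := by
    rw [Finsupp.sum_fintype _ _ (by simp), Finsupp.sum_fintype _ _ (by simp)]
    simp
  rw [h2]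
  refine le_of_sq_le_sq ?_ (by positivity)
  rw [mul_pow, key, key, Finset.mul_sum]
  refine Finset.sum_le_sum fun i _ => ?_
  rw [← mul_pow]
  exact pow_le_pow_left₀ (norm_nonneg _) (a.le_opNorm _) 2

theorem norm_lTensor_le (b : F →L[ℂ] F) (x : E ⊗[ℂ] F) :
    ‖(b : F →ₗ[ℂ] F).lTensor E x‖ ≤ ‖b‖ * ‖x‖ := by
  have h := norm_rTensor_le (F := E) b (TensorProduct.comm ℂ E F x)
  rw [← LinearMap.comm_comp_lTensor_comp_comm_eq] at h
  simpa using h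

/-- The Hilbert space tensor product: the completion of the algebraic tensor product. -/
abbrev HilbertTensor (E : Type u) (F : Type v) [NormedAddCommGroup E] [InnerProductSpace ℂ E]
    [NormedAddCommGroup F] [InnerProductSpace ℂ F] : Type (max u v) :=
  UniformSpace.Completion (E ⊗[ℂ] F)

/-- `a ⊗ b` on the algebraic tensor product, as a bounded operator. -/
def algTensorOp (a : E →L[ℂ] E) (b : F →L[ℂ] F) : (E ⊗[ℂ] F) →L[ℂ] (E ⊗[ℂ] F) :=
  LinearMap.mkContinuous (TensorProduct.map (a : E →ₗ[ℂ] E) (b : F →ₗ[ℂ] F)) (‖a‖ * ‖b‖) fun x => by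
    rw [← LinearMap.rTensor_comp_lTensor, LinearMap.comp_apply, mul_assoc]
    exact (norm_rTensor_le a _).trans
      (mul_le_mul_of_nonneg_left (norm_lTensor_le b x) (norm_nonneg a))

/-- The bounded operator `a ⊗ b` on the Hilbert space tensor product, characterised by
`(a ⊗ b) (ξ ⊗ η) = a ξ ⊗ b η`. -/
def tensorOp (a : E →L[ℂ] E) (b : F →L[ℂ] F) : HilbertTensor E F →L[ℂ] HilbertTensor E F :=
  (algTensorOp a b).completion

theorem tensorOp_tmul (a : E →L[ℂ] E) (b : F →L[ℂ] F) (ξ : E) (η : F) :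
    tensorOp a b ((ξ ⊗ₜ[ℂ] η : E ⊗[ℂ] F) : HilbertTensor E F) =
      ((a ξ ⊗ₜ[ℂ] b η : E ⊗[ℂ] F) : HilbertTensor E F) := by
  simp [tensorOp, algTensorOp]

theorem hilbertTensor_ext {S T : HilbertTensor E F →L[ℂ] HilbertTensor E F}
    (h : ∀ (ξ : E) (η : F), S ((ξ ⊗ₜ[ℂ] η : E ⊗[ℂ] F) : HilbertTensor E F) =
      T ((ξ ⊗ₜ[ℂ] η : E ⊗[ℂ] F) : HilbertTensor E F)) : S = T := by
  ext x
  induction x using UniformSpace.Completion.induction_on with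
  | hp => exact isClosed_eq S.continuous T.continuous
  | ih x =>
    induction x using TensorProduct.induction_on with
    | zero => rw [UniformSpace.Completion.coe_zero, map_zero, map_zero]
    | tmul ξ η => exact h ξ η
    | add x y hx hy => rw [UniformSpace.Completion.coe_add, map_add, map_add, hx, hy]

theorem tensorOp_mul (a a' : E →L[ℂ] E) (b b' : F →L[ℂ] F) :
    tensorOp a b * tensorOp a' b' = tensorOp (a * a') (b * b') :=
  hilbertTensor_ext fun ξ η => by simp [tensorOp_tmul]

theorem tensorOp_one : tensorOp (1 : E →L[ℂ] E) (1 : F →L[ℂ] F) = 1 :=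
  hilbertTensor_ext fun ξ η => by simp [tensorOp_tmul]

theorem tensorOp_add_right (a : E →L[ℂ] E) (b b' : F →L[ℂ] F) :
    tensorOp a (b + b') = tensorOp a b + tensorOp a b' :=
  hilbertTensor_ext fun ξ η => by
    simp [tensorOp_tmul, TensorProduct.tmul_add, UniformSpace.Completion.coe_add]

theorem tensorOp_smul_right (c : ℂ) (a : E →L[ℂ] E) (b : F →L[ℂ] F) :
    tensorOp a (c • b) = c • tensorOp a b :=
  hilbertTensor_ext fun ξ η => by
    simp [tensorOp_tmul, TensorProduct.tmul_smul, UniformSpace.Completion.coe_smul]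

theorem star_tensorOp [CompleteSpace E] [CompleteSpace F] (a : E →L[ℂ] E) (b : F →L[ℂ] F) :
    star (tensorOp a b) = tensorOp (star a) (star b) := by
  symm
  refine (ContinuousLinearMap.eq_adjoint_iff _ _).mpr fun x y => ?_
  induction x, y using UniformSpace.Completion.induction_on₂ with
  | hp => apply isClosed_eq <;> fun_prop
  | ih x y =>
    induction x using TensorProduct.induction_on with
    | zero => simp only [UniformSpace.Completion.coe_zero, map_zero, inner_zero_left]
    | add x x' hx hx' => simp only [UniformSpace.Completion.coe_add, map_add, inner_add_left, hx, hx']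
    | tmul ξ η =>
      induction y using TensorProduct.induction_on with
      | zero => simp only [UniformSpace.Completion.coe_zero, map_zero, inner_zero_right]
      | add y y' hy hy' =>
        simp only [UniformSpace.Completion.coe_add, map_add, inner_add_right, hy, hy']
      | tmul ξ' η' =>
        simp [tensorOp_tmul, ContinuousLinearMap.star_eq_adjoint,
          ContinuousLinearMap.adjoint_inner_left]

end Tensor


section Lattice

variable {X : Type u}

/-- `ℓ²(X)`, the Hilbert space with orthonormal basis `X`. -/
abbrev EllTwo (X : Type u) : Type u := lp (fun _ : X => ℂ) 2

theorem pequiv_memlp (f : X ≃. X) (ψ : X → ℂ) (hψ : Memℓp ψ 2) :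
    Memℓp (fun x => (f x).elim 0 ψ) 2 ∧
      ∑' x, ‖(f x).elim 0 ψ‖ ^ 2 ≤ ∑' x, ‖ψ x‖ ^ 2 := by
  have hs : Summable fun x => ‖ψ x‖ ^ 2 := by
    simpa using (memℓp_gen_iff (p := 2) (by norm_num)).mp hψ
  let D : Set X := {x | (f x).isSome}
  let i : D → X := fun x => (f x.1).get x.2
  have hi : Function.Injective i := by
    intro x y hxy
    have hx : f x.1 = some (i x) := by simp [i]
    have hy : f y.1 = some (i y) := by simp [i]
    exact Subtype.ext (f.inj hx (by rw [hy, hxy]; rfl))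
  have hval : ∀ x : D, (f x.1).elim 0 ψ = ψ (i x) := by
    intro x
    have hx : f x.1 = some (i x) := by simp [i]
    rw [hx]; rfl
  have hsupp : Function.support (fun x => ‖(f x).elim 0 ψ‖ ^ 2) ⊆ D := by
    intro x hx
    by_contra hD
    have : f x = none := by simpa [D] using hD
    simp [this] at hx
  have hsub : Summable ((fun y => ‖ψ y‖ ^ 2) ∘ i) := hs.comp_injective hi
  have hcomp : (fun x : D => ‖(f x.1).elim 0 ψ‖ ^ 2) = (fun y => ‖ψ y‖ ^ 2) ∘ i := by
    funext x
    simp only [hval, Function.comp_apply]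
  have hsum : Summable fun x => ‖(f x).elim 0 ψ‖ ^ 2 := by
    rw [← Set.indicator_eq_self.mpr hsupp]
    have h : Summable fun x : D => ‖(f x.1).elim 0 ψ‖ ^ 2 := by rw [hcomp]; exact hsub
    exact summable_subtype_iff_indicator.mp h
  refine ⟨?_, ?_⟩
  · refine (memℓp_gen_iff (p := 2) (by norm_num)).mpr ?_
    simpa using hsum
  · rw [← tsum_subtype_eq_of_support_subset hsupp, hcomp]
    exact hsub.tsum_le_tsum_of_inj i hi (fun _ _ => by positivity) (fun x => le_rfl) hs

/-- The partial isometry `(U_f ψ)(x) = ψ(f x)`, with value `0` where the partial injection `f` is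
undefined. -/
def pequivOp (f : X ≃. X) : EllTwo X →L[ℂ] EllTwo X :=
  LinearMap.mkContinuous
    { toFun := fun ψ => ⟨fun x => (f x).elim 0 ψ, (pequiv_memlp f ψ (lp.memℓp ψ)).1⟩
      map_add' := fun ψ φ => by
        ext x
        change (f x).elim 0 (⇑(ψ + φ)) = (f x).elim 0 ⇑ψ + (f x).elim 0 ⇑φ
        cases f x
        · exact (add_zero (0 : ℂ)).symm
        · rfl
      map_smul' := fun c ψ => by
        ext x
        change (f x).elim 0 (⇑(c • ψ)) = c • (f x).elim 0 ⇑ψ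
        cases f x
        · exact (mul_zero c).symm
        · rfl }
    1 fun ψ => by
      rw [one_mul]
      refine le_of_sq_le_sq ?_ (norm_nonneg _)
      have h1 := fun ψ : EllTwo X => lp.norm_rpow_eq_tsum (p := 2) (by norm_num) ψ
      simp only [ENNReal.toReal_ofNat, Real.rpow_ofNat] at h1
      rw [h1, h1]
      exact (pequiv_memlp f ψ (lp.memℓp ψ)).2

@[simp] theorem pequivOp_apply (f : X ≃. X) (ψ : EllTwo X) (x : X) :
    pequivOp f ψ x = (f x).elim 0 ψ := rfl

theorem pequivOp_mul (f g : X ≃. X) : pequivOp f * pequivOp g = pequivOp (f.trans g) := by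
  ext ψ x
  change (f x).elim 0 (fun y => (g y).elim 0 ψ) = ((f x).bind g).elim 0 ψ
  cases f x <;> rfl

theorem pequivOp_refl : pequivOp (PEquiv.refl X) = 1 := by
  ext ψ x
  rfl

theorem pequivOp_bot : pequivOp (⊥ : X ≃. X) = 0 := by
  ext ψ x
  rfl

theorem star_pequivOp (f : X ≃. X) : star (pequivOp f) = pequivOp f.symm := by
  symm
  refine (ContinuousLinearMap.eq_adjoint_iff _ _).mpr fun ψ φ => ?_
  rw [lp.inner_eq_tsum, lp.inner_eq_tsum]
  have hmem : ∀ y : Function.support (fun y => inner ℂ (ψ y) (pequivOp f φ y)),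
      (f y.1).isSome := by
    intro y
    by_contra h
    have h' : f y.1 = none := by simpa using h
    exact y.2 (by simp [h'])
  refine tsum_eq_tsum_of_ne_zero_bij (fun y => (f y.1).get (hmem y)) ?_ ?_ ?_
  · intro x y hxy
    have hx : f x.1 = some ((f x.1).get (hmem x)) := by simp
    have hy : f y.1 = some ((f y.1).get (hmem y)) := by simp
    refine Subtype.ext (f.inj hx ?_)
    rw [hy]
    exact congrArg some hxy.symm
  · intro x hx
    cases h : f.symm x with
    | none => exact absurd (by simp [h]) hx
    | some y =>
      have hy : f y = some x := (f.eq_some_iff).mp h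
      refine ⟨⟨y, ?_⟩, ?_⟩
      · simpa [h, hy] using hx
      · simp [hy]
  · intro y
    have hy : f y.1 = some ((f y.1).get (hmem y)) := by simp
    have hy' := (f.eq_some_iff).mpr hy
    have e1 : pequivOp f φ y.1 = φ ((f y.1).get (hmem y)) :=
      congrArg (fun o : Option X => o.elim 0 φ) hy
    have e2 : pequivOp f.symm ψ ((f y.1).get (hmem y)) = ψ y.1 :=
      congrArg (fun o : Option X => o.elim 0 ψ) hy'
    rw [e1, e2]

end Lattice

section QuasiLocal

/-- Classical spin configurations on `ℤ`: they label the product basis vectors of the chain. -/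
abbrev Config (d : ℕ) : Type := ℤ → Fin d

/-- The partial injection `σ ↦ σ[j := ν]`, defined on configurations with `σ j = μ`. -/
def siteFlip (d : ℕ) (j : ℤ) (μ ν : Fin d) : Config d ≃. Config d where
  toFun σ := if σ j = μ then some (Function.update σ j ν) else none
  invFun σ := if σ j = ν then some (Function.update σ j μ) else none
  inv σ τ := by
    have aux : ∀ (α β : Fin d) (σ τ : Config d),
        (if σ j = α then some (Function.update σ j β) else none) = some τ →
        (if τ j = β then some (Function.update τ j α) else none) = some σ := by
      intro α β σ τ h
      split_ifs at h with h1
      obtain rfl := Option.some.inj h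
      simp [← h1]
    exact ⟨aux _ _ _ _, aux _ _ _ _⟩

/-- The matrix unit `e_{μν}` acting on site `j` of the chain: it maps the basis vector of a
configuration `τ` with `τ j = ν` to that of `τ[j := μ]`, and all the other basis vectors to `0`. -/
def siteUnit (d : ℕ) (j : ℤ) (μ ν : Fin d) : EllTwo (Config d) →L[ℂ] EllTwo (Config d) :=
  pequivOp (siteFlip d j μ ν)

theorem siteUnit_mul (d : ℕ) (j : ℤ) (μ ν ν' ρ : Fin d) :
    siteUnit d j μ ν * siteUnit d j ν' ρ = if ν = ν' then siteUnit d j μ ρ else 0 := by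
  have h : (siteFlip d j μ ν).trans (siteFlip d j ν' ρ) =
      if ν = ν' then siteFlip d j μ ρ else ⊥ := by
    refine PEquiv.ext fun σ => ?_
    change (if σ j = μ then some (Function.update σ j ν) else none).bind
      (fun τ => if τ j = ν' then some (Function.update τ j ρ) else none) = _
    by_cases h1 : σ j = μ <;> by_cases h2 : ν = ν' <;> simp [siteFlip, h1, h2]
  rw [siteUnit, siteUnit, pequivOp_mul, h]
  split_ifs
  · rfl
  · exact pequivOp_bot

theorem siteUnit_comm (d : ℕ) {j k : ℤ} (hjk : j ≠ k) (μ ν μ' ν' : Fin d) :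
    siteUnit d j μ ν * siteUnit d k μ' ν' = siteUnit d k μ' ν' * siteUnit d j μ ν := by
  have h : (siteFlip d j μ ν).trans (siteFlip d k μ' ν') =
      (siteFlip d k μ' ν').trans (siteFlip d j μ ν) := by
    refine PEquiv.ext fun σ => ?_
    change (if σ j = μ then some (Function.update σ j ν) else none).bind
      (fun τ => if τ k = μ' then some (Function.update τ k ν') else none) =
      (if σ k = μ' then some (Function.update σ k ν') else none).bind
      (fun τ => if τ j = μ then some (Function.update τ j ν) else none)
    by_cases h1 : σ j = μ <;> by_cases h2 : σ k = μ' <;>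
      simp [h1, h2, hjk, hjk.symm, Function.update_comm hjk]
  rw [siteUnit, siteUnit, pequivOp_mul, h, pequivOp_mul]

theorem star_siteUnit (d : ℕ) (j : ℤ) (μ ν : Fin d) :
    star (siteUnit d j μ ν) = siteUnit d j ν μ :=
  star_pequivOp _

theorem sum_siteUnit (d : ℕ) (j : ℤ) : ∑ μ, siteUnit d j μ μ = 1 := by
  refine ContinuousLinearMap.ext fun ψ => lp.ext (funext fun σ => ?_)
  have h : ∀ μ, siteUnit d j μ μ ψ σ = if σ j = μ then ψ σ else 0 := by
    intro μ
    change (if σ j = μ then some (Function.update σ j μ) else none).elim 0 ψ = _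
    split_ifs with h1
    · simp [← h1]
    · rfl
  simp only [_root_.sum_apply, lp.coeFn_sum, Finset.sum_apply, h]
  simp

/-- `Q ↦ Q^{(j)}`: the matrix `Q` acting on site `j` of the chain, tensored with the identity on
all the other sites. -/
def site (d : ℕ) (j : ℤ) :
    Matrix (Fin d) (Fin d) ℂ →⋆ₐ[ℂ] (EllTwo (Config d) →L[ℂ] EllTwo (Config d)) where
  toFun Q := ∑ μ, ∑ ν, Q μ ν • siteUnit d j μ ν
  map_one' := by simp [Matrix.one_apply, sum_siteUnit]
  map_zero' := by simp
  map_add' Q Q' := by simp [add_smul, Finset.sum_add_distrib]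
  map_mul' Q Q' := by
    have h : ∀ μ ν, (Q μ ν • siteUnit d j μ ν) * (∑ ν', ∑ ρ, Q' ν' ρ • siteUnit d j ν' ρ) =
        ∑ ρ, (Q μ ν * Q' ν ρ) • siteUnit d j μ ρ := by
      intro μ ν
      rw [Finset.mul_sum, Finset.sum_eq_single ν]
      · simp [Finset.mul_sum, smul_mul_smul_comm, siteUnit_mul, -Algebra.mul_smul_comm,
          -Algebra.smul_mul_assoc]
      · intro ν' _ hν'
        simp [Finset.mul_sum, smul_mul_smul_comm, siteUnit_mul, hν'.symm, -Algebra.mul_smul_comm,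
          -Algebra.smul_mul_assoc]
      · simp
    simp only [Finset.sum_mul, h, Matrix.mul_apply, Finset.sum_smul]
    exact Finset.sum_congr rfl fun μ _ => Finset.sum_comm
  commutes' c := by
    simp [Matrix.algebraMap_matrix_apply, Algebra.algebraMap_eq_smul_one, ← sum_siteUnit d j,
      Finset.smul_sum]
  map_star' Q := by
    simp only [star_sum, star_smul, star_siteUnit, Matrix.star_apply]
    exact Finset.sum_comm

theorem site_commute (d : ℕ) {j k : ℤ} (hjk : j ≠ k) (Q Q' : Matrix (Fin d) (Fin d) ℂ) :
    Commute (site d j Q) (site d k Q') := by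
  refine Commute.sum_left _ _ _ fun μ _ => Commute.sum_left _ _ _ fun ν _ =>
    Commute.sum_right _ _ _ fun μ' _ => Commute.sum_right _ _ _ fun ν' _ => ?_
  exact ((show Commute _ _ from siteUnit_comm d hjk μ ν μ' ν').smul_left _).smul_right _

/-- The C⋆-algebra of observables of the spin chain supported in `S ⊆ ℤ`: the norm closure of the
⋆-algebra generated by the single-site observables `Q^{(j)}`, `j ∈ S`. The observables of the
different sites commute and each site carries a unital copy of `M_d`, so for a finite set `Λ` of
sites the generated algebra is `⨂_{z ∈ Λ} M_d` with its C⋆-norm, and `siteAlgebra d S` is the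
C⋆-inductive limit of these algebras over the finite `Λ ⊆ S`. -/
def siteAlgebra (d : ℕ) (S : Set ℤ) :
    StarSubalgebra ℂ (EllTwo (Config d) →L[ℂ] EllTwo (Config d)) :=
  (StarAlgebra.adjoin ℂ {T | ∃ j ∈ S, ∃ Q, T = site d j Q}).topologicalClosure

theorem site_mem (d : ℕ) {S : Set ℤ} {j : ℤ} (hj : j ∈ S) (Q : Matrix (Fin d) (Fin d) ℂ) :
    site d j Q ∈ siteAlgebra d S :=
  StarSubalgebra.le_topologicalClosure _ (StarAlgebra.subset_adjoin ℂ _ ⟨j, hj, Q, rfl⟩)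

theorem siteAlgebra_mono (d : ℕ) {S T : Set ℤ} (h : S ⊆ T) : siteAlgebra d S ≤ siteAlgebra d T :=
  StarSubalgebra.topologicalClosure_mono (StarAlgebra.adjoin_mono
    fun _ ⟨j, hj, Q, hQ⟩ => ⟨j, h hj, Q, hQ⟩)

/-- The quasi-local algebra `𝒜` of the two-sided chain. -/
abbrev AlgZ (d : ℕ) := siteAlgebra d Set.univ

/-- The algebra `𝒜_R` of the right half-infinite chain `[0, ∞)`. -/
abbrev AlgR (d : ℕ) := siteAlgebra d (Set.Ici 0)

/-- The algebra `𝒜_L` of the left half-infinite chain `(-∞, -1]`. -/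
abbrev AlgL (d : ℕ) := siteAlgebra d (Set.Iic (-1))

theorem coe_inclusion {B : Type u} [Ring B] [StarRing B] [Algebra ℂ B] [StarModule ℂ B]
    {S T : StarSubalgebra ℂ B} (h : S ≤ T) (x : S) :
    (StarSubalgebra.inclusion h x : B) = x := rfl

/-- The inclusion `A ↦ 𝕀 ⊗ A` of `𝒜_R` in `𝒜`. -/
def inclR (d : ℕ) : AlgR d →⋆ₐ[ℂ] AlgZ d :=
  StarSubalgebra.inclusion (siteAlgebra_mono d (Set.subset_univ _))

/-- The inclusion `B ↦ B ⊗ 𝕀` of `𝒜_L` in `𝒜`. -/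
def inclL (d : ℕ) : AlgL d →⋆ₐ[ℂ] AlgZ d :=
  StarSubalgebra.inclusion (siteAlgebra_mono d (Set.subset_univ _))

theorem coe_inclR (d : ℕ) (A : AlgR d) :
    (inclR d A : EllTwo (Config d) →L[ℂ] EllTwo (Config d)) = A := coe_inclusion _ A

theorem coe_inclL (d : ℕ) (B : AlgL d) :
    (inclL d B : EllTwo (Config d) →L[ℂ] EllTwo (Config d)) = B := coe_inclusion _ B

/-- The reflection `j ↦ -j-1` of the sites, acting on configurations. -/
def configReflect (d : ℕ) : Config d ≃ Config d where
  toFun σ j := σ (-j - 1)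
  invFun σ j := σ (-j - 1)
  left_inv σ := by funext j; simp
  right_inv σ := by funext j; simp

/-- The unitary on `ℓ²` of the configurations which permutes the basis by the reflection. -/
def reflectUnitary (d : ℕ) : unitary (EllTwo (Config d) →L[ℂ] EllTwo (Config d)) :=
  ⟨pequivOp (configReflect d).toPEquiv, by
    constructor <;>
      rw [star_pequivOp, pequivOp_mul, ← Equiv.toPEquiv_symm, ← Equiv.toPEquiv_trans] <;>
      simp [pequivOp_refl]⟩

/-- Conjugation by the reflection of the basis. -/
def reflectOp (d : ℕ) : (EllTwo (Config d) →L[ℂ] EllTwo (Config d)) ≃⋆ₐ[ℂ]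
    (EllTwo (Config d) →L[ℂ] EllTwo (Config d)) :=
  Unitary.conjStarAlgAut ℂ _ (reflectUnitary d)

theorem reflectOp_site (d : ℕ) (j : ℤ) (Q : Matrix (Fin d) (Fin d) ℂ) :
    reflectOp d (site d j Q) = site d (-j - 1) Q := by
  have h : ∀ μ ν, reflectOp d (siteUnit d j μ ν) = siteUnit d (-j - 1) μ ν := by
    intro μ ν
    rw [reflectOp, Unitary.conjStarAlgAut_apply]
    change pequivOp _ * siteUnit d j μ ν * star (pequivOp _) = _
    rw [star_pequivOp, siteUnit, pequivOp_mul, pequivOp_mul, siteUnit]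
    congr 1
    refine PEquiv.ext fun σ => ?_
    change ((some (configReflect d σ)).bind
      (fun τ => if τ j = μ then some (Function.update τ j ν) else none)).bind
      (fun τ => some (configReflect d τ)) =
      if σ (-j - 1) = μ then some (Function.update σ (-j - 1) ν) else none
    have h0 : configReflect d σ j = σ (-j - 1) := rfl
    simp only [Option.bind_some, h0]
    split_ifs with h1
    · simp only [Option.bind_some, Option.some.injEq]
      funext k
      change Function.update (configReflect d σ) j ν (-k - 1) = _
      by_cases hk : k = -j - 1
      · subst hk; simp
      · rw [Function.update_of_ne hk, Function.update_of_ne (by omega)]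
        change σ (-(-k - 1) - 1) = _
        congr 1; omega
    · rfl
  change reflectOp d (∑ μ, ∑ ν, Q μ ν • siteUnit d j μ ν) = _
  simp only [map_sum, map_smul, h]
  rfl

theorem reflectOp_reflectOp (d : ℕ) (T : EllTwo (Config d) →L[ℂ] EllTwo (Config d)) :
    reflectOp d (reflectOp d T) = T := by
  have h : reflectUnitary d * reflectUnitary d = 1 := by
    refine Subtype.ext ?_
    change pequivOp _ * pequivOp _ = 1
    rw [pequivOp_mul, ← Equiv.toPEquiv_trans, show (configReflect d).trans (configReflect d) =
      Equiv.refl _ from (configReflect d).self_trans_symm, Equiv.toPEquiv_refl, pequivOp_refl]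
  rw [reflectOp, ← Unitary.conjStarAlgAut_mul_apply, h, map_one]
  rfl

theorem reflectOp_mem (d : ℕ) {S T : Set ℤ} (h : ∀ j ∈ S, -j - 1 ∈ T)
    {A : EllTwo (Config d) →L[ℂ] EllTwo (Config d)} (hA : A ∈ siteAlgebra d S) :
    reflectOp d A ∈ siteAlgebra d T := by
  have hcont : Continuous (reflectOp d) := by
    change Continuous fun x => reflectOp d x
    simp only [reflectOp, Unitary.conjStarAlgAut_apply]
    fun_prop
  have hle : siteAlgebra d S ≤ (siteAlgebra d T).comap (reflectOp d : _ →⋆ₐ[ℂ] _) := by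
    refine StarSubalgebra.topologicalClosure_minimal (StarAlgebra.adjoin_le ?_) ?_
    · rintro _ ⟨j, hj, Q, rfl⟩
      change reflectOp d (site d j Q) ∈ siteAlgebra d T
      rw [reflectOp_site]
      exact site_mem d (h j hj) Q
    · exact (StarSubalgebra.isClosed_topologicalClosure _).preimage hcont
  exact hle hA

/-- Restriction of a ⋆-automorphism of period two to a ⋆-isomorphism of ⋆-subalgebras which it
exchanges. -/
def restrictInvolution {B : Type u} [Ring B] [StarRing B] [Algebra ℂ B] [StarModule ℂ B]
    (e : B ≃⋆ₐ[ℂ] B) (he : ∀ x, e (e x) = x) (S T : StarSubalgebra ℂ B)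
    (hST : ∀ x ∈ S, e x ∈ T) (hTS : ∀ x ∈ T, e x ∈ S) : S ≃⋆ₐ[ℂ] T where
  toFun x := ⟨e x, hST x x.2⟩
  invFun x := ⟨e x, hTS x x.2⟩
  left_inv x := Subtype.ext (he x)
  right_inv x := Subtype.ext (he x)
  map_mul' x y := Subtype.ext (map_mul e x.1 y.1)
  map_add' x y := Subtype.ext (map_add e x.1 y.1)
  map_star' x := Subtype.ext (map_star e x.1)
  map_smul' c x := Subtype.ext (map_smul e c x.1)

theorem coe_restrictInvolution {B : Type u} [Ring B] [StarRing B] [Algebra ℂ B] [StarModule ℂ B]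
    (e : B ≃⋆ₐ[ℂ] B) (he : ∀ x, e (e x) = x) (S T : StarSubalgebra ℂ B)
    (hST : ∀ x ∈ S, e x ∈ T) (hTS : ∀ x ∈ T, e x ∈ S) (x : S) :
    (restrictInvolution e he S T hST hTS x : B) = e x := rfl

/-- The ⋆-isomorphism between the algebras of a set `S` of sites and of its mirror image `T`. -/
def reflectEquiv (d : ℕ) (S T : Set ℤ) (hST : ∀ j ∈ S, -j - 1 ∈ T) (hTS : ∀ j ∈ T, -j - 1 ∈ S) :
    siteAlgebra d S ≃⋆ₐ[ℂ] siteAlgebra d T :=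
  restrictInvolution (reflectOp d) (reflectOp_reflectOp d) _ _
    (fun _ hA => reflectOp_mem d hST hA) (fun _ hA => reflectOp_mem d hTS hA)

theorem coe_reflectEquiv (d : ℕ) (S T : Set ℤ) (hST : ∀ j ∈ S, -j - 1 ∈ T)
    (hTS : ∀ j ∈ T, -j - 1 ∈ S) (A : siteAlgebra d S) :
    (reflectEquiv d S T hST hTS A : EllTwo (Config d) →L[ℂ] EllTwo (Config d)) =
      reflectOp d A :=
  coe_restrictInvolution _ _ _ _ _ _ A

/-- The reflection automorphism `γ` of `𝒜`. -/
def reflection (d : ℕ) : AlgZ d ≃⋆ₐ[ℂ] AlgZ d :=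
  reflectEquiv d Set.univ Set.univ (fun _ _ => Set.mem_univ _) (fun _ _ => Set.mem_univ _)

/-- The ⋆-isomorphism `γ_{L → R}` of `𝒜_L` onto `𝒜_R`. -/
def reflectLR (d : ℕ) : AlgL d ≃⋆ₐ[ℂ] AlgR d :=
  reflectEquiv d (Set.Iic (-1)) (Set.Ici 0)
    (fun j hj => by simp only [Set.mem_Iic, Set.mem_Ici] at *; omega)
    (fun j hj => by simp only [Set.mem_Iic, Set.mem_Ici] at *; omega)

theorem coe_reflection (d : ℕ) (A : AlgZ d) :
    (reflection d A : EllTwo (Config d) →L[ℂ] EllTwo (Config d)) = reflectOp d A :=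
  coe_reflectEquiv d _ _ _ _ A

theorem coe_reflectLR (d : ℕ) (B : AlgL d) :
    (reflectLR d B : EllTwo (Config d) →L[ℂ] EllTwo (Config d)) = reflectOp d B :=
  coe_reflectEquiv d _ _ _ _ B

/-- The defining property of `γ`: it maps `Q^{(j)}` to `Q^{(-j-1)}`. -/
theorem reflection_site (d : ℕ) (j : ℤ) (Q : Matrix (Fin d) (Fin d) ℂ) :
    reflection d ⟨site d j Q, site_mem d (Set.mem_univ j) Q⟩ =
      ⟨site d (-j - 1) Q, site_mem d (Set.mem_univ _) Q⟩ :=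
  Subtype.ext (reflectOp_site d j Q)

/-- The defining property of `γ_{L → R}`: `γ (B ⊗ 𝕀) = 𝕀 ⊗ γ_{L → R} B`. -/
theorem reflection_inclL (d : ℕ) (B : AlgL d) :
    reflection d (inclL d B) = inclR d (reflectLR d B) :=
  Subtype.ext <| (coe_reflection d _).trans <| (congrArg (reflectOp d) (coe_inclL d B)).trans <|
    (coe_reflectLR d B).symm.trans (coe_inclR d _).symm

end QuasiLocal

section Representations

/-- A state: a positive linear functional with `φ 1 = 1` (it is automatically bounded). -/
def IsState {A : Type u} [Ring A] [StarRing A] [Algebra ℂ A] (φ : A →ₗ[ℂ] ℂ) : Prop :=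
  (∀ a, 0 ≤ φ (star a * a)) ∧ φ 1 = 1

/-- A pure state: an extreme point of the convex set of the states. -/
def IsPureState {A : Type u} [Ring A] [StarRing A] [Algebra ℂ A] (φ : A →ₗ[ℂ] ℂ) : Prop :=
  φ ∈ Set.extremePoints ℝ {ψ : A →ₗ[ℂ] ℂ | IsState ψ}

variable {A : Type u} [Ring A] [StarRing A] [Algebra ℂ A]
  {H : Type v} [NormedAddCommGroup H] [InnerProductSpace ℂ H] [CompleteSpace H]

/-- `(H, π, Ω)` is a GNS triple of `φ`: the vector `Ω` is cyclic for `π` and implements `φ`. -/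
def IsGNSTriple (φ : A →ₗ[ℂ] ℂ) (π : A →⋆ₐ[ℂ] (H →L[ℂ] H)) (Ω : H) : Prop :=
  (∀ a, ⟪Ω, π a Ω⟫_ℂ = φ a) ∧ DenseRange fun a => π a Ω

/-- `(H, π)` is irreducible: `H ≠ 0` and the only closed invariant subspaces are `0` and `H`. -/
def IsIrreducibleRep (π : A →⋆ₐ[ℂ] (H →L[ℂ] H)) : Prop :=
  Nontrivial H ∧ ∀ W : Submodule ℂ H, IsClosed (W : Set H) → (∀ a, ∀ v ∈ W, π a v ∈ W) →
    W = ⊥ ∨ W = ⊤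

/-- The von Neumann algebra `π(A)''` generated by a representation. -/
def bicommutant (π : A →⋆ₐ[ℂ] (H →L[ℂ] H)) : VonNeumannAlgebra H where
  toStarSubalgebra := StarSubalgebra.centralizer ℂ
    (StarSubalgebra.centralizer ℂ (Set.range π) : Set (H →L[ℂ] H))
  centralizer_centralizer' := by simp

/-- The carrier of `bicommutant π` is the bicommutant of `π(A)`. -/
theorem coe_bicommutant (π : A →⋆ₐ[ℂ] (H →L[ℂ] H)) :
    (bicommutant π : Set (H →L[ℂ] H)) = Set.centralizer (Set.centralizer (Set.range π)) := by
  have h : ∀ T : Set (H →L[ℂ] H), star T = T →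
      (StarSubalgebra.centralizer ℂ T : Set (H →L[ℂ] H)) = Set.centralizer T := by
    intro T hT
    rw [StarSubalgebra.coe_centralizer, hT, Set.union_self]
  have h1 : star (Set.range π) = Set.range π := by
    ext x
    constructor
    · rintro ⟨a, ha⟩
      exact ⟨star a, by rw [map_star, ha, star_star]⟩
    · rintro ⟨a, rfl⟩
      exact ⟨star a, by rw [map_star]⟩
  change (StarSubalgebra.centralizer ℂ
    (StarSubalgebra.centralizer ℂ (Set.range π) : Set (H →L[ℂ] H)) : Set (H →L[ℂ] H)) = _
  rw [h _ h1, h _ (by rw [Set.star_centralizer, h1])]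

/-- A type I factor: a von Neumann algebra which is ⋆-isomorphic to the algebra of all the bounded
operators on a (nonzero) Hilbert space. -/
def IsTypeIFactor (M : VonNeumannAlgebra H) : Prop :=
  ∃ (K : Type v) (_ : NormedAddCommGroup K) (_ : InnerProductSpace ℂ K) (_ : CompleteSpace K),
    Nontrivial K ∧ Nonempty (M.toStarSubalgebra ≃⋆ₐ[ℂ] (K →L[ℂ] K))

/-- The support projection of the vector `Ω` in the algebra `N`: the least projection of `N`
which fixes `Ω`. -/
def IsSupportProjection (N : StarSubalgebra ℂ (H →L[ℂ] H)) (Ω : H) (q : H →L[ℂ] H) : Prop :=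
  IsLeast {q | q ∈ N ∧ IsStarProjection q ∧ q Ω = Ω} q

/-- `x ↦ 𝕀 ⊗ x`. -/
def rightEmbed (H : Type v) [NormedAddCommGroup H] [InnerProductSpace ℂ H] [CompleteSpace H] :
    (H →L[ℂ] H) →⋆ₐ[ℂ] (HilbertTensor H H →L[ℂ] HilbertTensor H H) where
  toFun x := tensorOp 1 x
  map_one' := tensorOp_one
  map_zero' := by simpa using tensorOp_smul_right 0 (1 : H →L[ℂ] H) (0 : H →L[ℂ] H)
  map_mul' x y := by rw [tensorOp_mul, one_mul]
  map_add' x y := tensorOp_add_right _ _ _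
  commutes' c := by
    rw [Algebra.algebraMap_eq_smul_one, tensorOp_smul_right, tensorOp_one,
      Algebra.algebraMap_eq_smul_one]
  map_star' x := by rw [star_tensorOp, star_one]

/-- The algebra `𝕀 ⊗ B(H)`. -/
def rightFactor (H : Type v) [NormedAddCommGroup H] [InnerProductSpace ℂ H] [CompleteSpace H] :
    StarSubalgebra ℂ (HilbertTensor H H →L[ℂ] HilbertTensor H H) :=
  (rightEmbed H).range

end Representations

section Split

/-- A state of the chain is reflection invariant if `ω ∘ γ = ω`. -/
def IsReflectionInvariant {d : ℕ} (ω : AlgZ d →ₗ[ℂ] ℂ) : Prop :=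
  ∀ A, ω (reflection d A) = ω A

/-- The restriction of a functional to the right half-infinite chain. -/
def restrictR {d : ℕ} (ω : AlgZ d →ₗ[ℂ] ℂ) : AlgR d →ₗ[ℂ] ℂ :=
  ω ∘ₗ (inclR d : AlgR d →ₐ[ℂ] AlgZ d).toLinearMap

/-- The split property with respect to `𝒜_L` and `𝒜_R`: in the GNS representation of the
restriction of `ω` to `𝒜_R` (which is unique up to unitary equivalence), the von Neumann algebra
generated by `𝒜_R` is a type I factor. -/
def IsSplit {d : ℕ} (ω : AlgZ d →ₗ[ℂ] ℂ) : Prop :=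
  ∃ (K : Type) (_ : NormedAddCommGroup K) (_ : InnerProductSpace ℂ K) (_ : CompleteSpace K)
    (π : AlgR d →⋆ₐ[ℂ] (K →L[ℂ] K)) (Ω : K),
    IsGNSTriple (restrictR ω) π Ω ∧ IsTypeIFactor (bicommutant π)

/-- A reflection-split representation of `ω` on `H`. -/
structure ReflectionSplitRep {d : ℕ} (ω : AlgZ d →ₗ[ℂ] ℂ) (H : Type v) [NormedAddCommGroup H]
    [InnerProductSpace ℂ H] [CompleteSpace H] where
  /-- the representation `π_ω` of `𝒜_R` on `H` -/
  π : AlgR d →⋆ₐ[ℂ] (H →L[ℂ] H)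
  irreducible : IsIrreducibleRep π
  /-- the representation `(π_ω ∘ γ_{L → R}) ⊗ π_ω` of `𝒜 = 𝒜_L ⊗ 𝒜_R` on `H ⊗ H`; the next field
  says that it is this tensor product, and determines it -/
  πHat : AlgZ d →⋆ₐ[ℂ] (HilbertTensor H H →L[ℂ] HilbertTensor H H)
  πHat_apply : ∀ (B : AlgL d) (A : AlgR d),
    πHat (inclL d B * inclR d A) = tensorOp (π (reflectLR d B)) (π A)
  /-- the vector `Ω_ω` -/
  Ω : HilbertTensor H H
  norm_Ω : ‖Ω‖ = 1
  gns : IsGNSTriple ω πHat Ω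
  /-- the unitary `Γ_ω` -/
  Γ : HilbertTensor H H ≃ₗᵢ[ℂ] HilbertTensor H H
  Γ_apply : ∀ A, Γ (πHat A Ω) = πHat (reflection d A) Ω

end Split

section Corner

variable {H : Type v} [NormedAddCommGroup H] [InnerProductSpace ℂ H]

/-- The subspace `sH` for a projection `s`, as the set of the vectors fixed by `s`. -/
def projSpace (s : H →L[ℂ] H) : Submodule ℂ H := LinearMap.ker ((1 - s : H →L[ℂ] H) : H →ₗ[ℂ] H)

theorem mem_projSpace {s : H →L[ℂ] H} {v : H} : v ∈ projSpace s ↔ s v = v := by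
  rw [projSpace, LinearMap.mem_ker]
  exact sub_eq_zero.trans eq_comm

theorem isClosed_projSpace (s : H →L[ℂ] H) : IsClosed (projSpace s : Set H) :=
  (1 - s).isClosed_ker

variable [CompleteSpace H]

instance completeSpace_projSpace (s : H →L[ℂ] H) : CompleteSpace (projSpace s) :=
  (isClosed_projSpace s).completeSpace_coe

theorem projSpace_eq_range {s : H →L[ℂ] H} (hs : IsStarProjection s) :
    projSpace s = LinearMap.range (s : H →ₗ[ℂ] H) := by
  ext v
  rw [mem_projSpace]
  constructor
  · exact fun h => ⟨v, h⟩
  · rintro ⟨w, rfl⟩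
    exact congrArg (fun t : H →L[ℂ] H => t w) hs.isIdempotentElem

/-- An operator on `sH`, extended by `0` to the orthogonal complement of `sH`. -/
def extendOp (s : H →L[ℂ] H) (x : projSpace s →L[ℂ] projSpace s) : H →L[ℂ] H :=
  (projSpace s).subtypeL ∘L x ∘L (projSpace s).orthogonalProjectionOnto

/-- The compression `p T p` of `T`, as an operator on `pH`. -/
def compressOp (p T : H →L[ℂ] H) : projSpace p →L[ℂ] projSpace p :=
  (projSpace p).orthogonalProjectionOnto ∘L T ∘L (projSpace p).subtypeL

theorem subtypeL_comp_orthogonalProjectionOnto {p : H →L[ℂ] H} (hp : IsStarProjection p) :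
    (projSpace p).subtypeL ∘L (projSpace p).orthogonalProjectionOnto = p := by
  ext v
  refine Submodule.eq_starProjection_of_mem_of_inner_eq_zero ?_ ?_
  · exact mem_projSpace.mpr (congrArg (fun t : H →L[ℂ] H => t v) hp.isIdempotentElem)
  · intro w hw
    have h : ⟪p v, w⟫_ℂ = ⟪v, w⟫_ℂ := by
      rw [← ContinuousLinearMap.adjoint_inner_right, ← ContinuousLinearMap.star_eq_adjoint,
        hp.isSelfAdjoint.star_eq, mem_projSpace.mp hw]
    rw [inner_sub_left, h, sub_self]

theorem orthogonalProjectionOnto_comp_subtypeL (p : H →L[ℂ] H) :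
    (projSpace p).orthogonalProjectionOnto ∘L (projSpace p).subtypeL = 1 := by
  ext v
  simp

theorem extendOp_one {s : H →L[ℂ] H} (hs : IsStarProjection s) : extendOp s 1 = s :=
  subtypeL_comp_orthogonalProjectionOnto hs

theorem extendOp_mul (s : H →L[ℂ] H) (x y : projSpace s →L[ℂ] projSpace s) :
    extendOp s (x * y) = extendOp s x * extendOp s y := by
  ext v
  simp [extendOp]

theorem star_extendOp (s : H →L[ℂ] H) (x : projSpace s →L[ℂ] projSpace s) :
    star (extendOp s x) = extendOp s (star x) := by
  simp only [extendOp, ContinuousLinearMap.star_eq_adjoint, ContinuousLinearMap.adjoint_comp,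
    Submodule.adjoint_subtypeL, Submodule.adjoint_orthogonalProjectionOnto]
  rfl

theorem mul_extendOp {s : H →L[ℂ] H} (x : projSpace s →L[ℂ] projSpace s) :
    s * extendOp s x = extendOp s x := by
  ext v
  exact mem_projSpace.mp (x ((projSpace s).orthogonalProjectionOnto v)).2

theorem star_compressOp (p T : H →L[ℂ] H) : star (compressOp p T) = compressOp p (star T) := by
  simp only [compressOp, ContinuousLinearMap.star_eq_adjoint, ContinuousLinearMap.adjoint_comp,
    Submodule.adjoint_subtypeL, Submodule.adjoint_orthogonalProjectionOnto]
  rfl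

theorem compressOp_mul {p : H →L[ℂ] H} (hp : IsStarProjection p) (S T : H →L[ℂ] H)
    (hT : p * T = T) : compressOp p (S * T) = compressOp p S * compressOp p T := by
  conv_lhs => rw [← hT]
  conv_lhs => enter [2, 2, 1]; rw [← subtypeL_comp_orthogonalProjectionOnto hp]
  rfl

theorem compressOp_self {p : H →L[ℂ] H} : compressOp p p = 1 := by
  ext v
  have h : p (v : H) = v := mem_projSpace.mp v.2
  simp [compressOp, h]

theorem isStarProjection_tensorOp {s : H →L[ℂ] H} (hs : IsStarProjection s) :
    IsStarProjection (tensorOp s s) where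
  isIdempotentElem := by rw [IsIdempotentElem, tensorOp_mul, hs.isIdempotentElem.eq]
  isSelfAdjoint := by rw [IsSelfAdjoint, star_tensorOp, hs.isSelfAdjoint.star_eq]

/-- The subspace `p Ĥ = sH ⊗ sH` of `Ĥ = H ⊗ H`, where `p = s ⊗ s`. -/
abbrev cornerSpace (s : H →L[ℂ] H) : Submodule ℂ (HilbertTensor H H) := projSpace (tensorOp s s)

/-- The operator `s ⊗ x` on `p Ĥ`, for `x ∈ B(sH)`. -/
def cornerRight (s : H →L[ℂ] H) (x : projSpace s →L[ℂ] projSpace s) :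
    cornerSpace s →L[ℂ] cornerSpace s :=
  compressOp (tensorOp s s) (tensorOp s (extendOp s x))

/-- The operator `x ⊗ s` on `p Ĥ`, for `x ∈ B(sH)`. -/
def cornerLeft (s : H →L[ℂ] H) (x : projSpace s →L[ℂ] projSpace s) :
    cornerSpace s →L[ℂ] cornerSpace s :=
  compressOp (tensorOp s s) (tensorOp (extendOp s x) s)

theorem cornerRight_one {s : H →L[ℂ] H} (hs : IsStarProjection s) : cornerRight s 1 = 1 := by
  rw [cornerRight, extendOp_one hs, compressOp_self]

theorem cornerRight_smul (s : H →L[ℂ] H) (c : ℂ) (x : projSpace s →L[ℂ] projSpace s) :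
    cornerRight s (c • x) = c • cornerRight s x := by
  have h : extendOp s (c • x) = c • extendOp s x := by ext v; simp [extendOp]
  rw [cornerRight, h, tensorOp_smul_right]
  ext v; simp [cornerRight, compressOp]

theorem cornerRight_add (s : H →L[ℂ] H) (x y : projSpace s →L[ℂ] projSpace s) :
    cornerRight s (x + y) = cornerRight s x + cornerRight s y := by
  have h : extendOp s (x + y) = extendOp s x + extendOp s y := by ext v; simp [extendOp]
  rw [cornerRight, h, tensorOp_add_right]
  ext v; simp [cornerRight, compressOp]

theorem cornerRight_mul {s : H →L[ℂ] H} (hs : IsStarProjection s)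
    (x y : projSpace s →L[ℂ] projSpace s) :
    cornerRight s (x * y) = cornerRight s x * cornerRight s y := by
  have h : tensorOp s (extendOp s (x * y)) =
      tensorOp s (extendOp s x) * tensorOp s (extendOp s y) := by
    rw [tensorOp_mul, extendOp_mul, hs.isIdempotentElem.eq]
  rw [cornerRight, h, compressOp_mul (isStarProjection_tensorOp hs)]
  · rfl
  · rw [tensorOp_mul, hs.isIdempotentElem.eq, mul_extendOp]

theorem star_cornerRight {s : H →L[ℂ] H} (hs : IsStarProjection s)
    (x : projSpace s →L[ℂ] projSpace s) :
    star (cornerRight s x) = cornerRight s (star x) := by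
  rw [cornerRight, star_compressOp, star_tensorOp, hs.isSelfAdjoint.star_eq, star_extendOp]
  rfl

/-- The ⋆-homomorphism `x ↦ s ⊗ x`, from `B(sH)` to `B(p Ĥ)`. -/
def cornerHom {s : H →L[ℂ] H} (hs : IsStarProjection s) :
    (projSpace s →L[ℂ] projSpace s) →⋆ₐ[ℂ] (cornerSpace s →L[ℂ] cornerSpace s) where
  toFun := cornerRight s
  map_one' := cornerRight_one hs
  map_zero' := by
    have h := cornerRight_add s 0 0
    rw [add_zero] at h
    exact left_eq_add.mp h
  map_mul' := cornerRight_mul hs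
  map_add' := cornerRight_add s
  commutes' c := by
    rw [Algebra.algebraMap_eq_smul_one, cornerRight_smul, cornerRight_one hs,
      Algebra.algebraMap_eq_smul_one]
  map_star' x := (star_cornerRight hs x).symm

/-- The von Neumann algebra `s ⊗ B(sH)` on `p Ĥ`. -/
def cornerAlgebra {s : H →L[ℂ] H} (hs : IsStarProjection s) :
    StarSubalgebra ℂ (cornerSpace s →L[ℂ] cornerSpace s) :=
  StarAlgHom.range (A := projSpace s →L[ℂ] projSpace s) (cornerHom hs)

end Corner

section CornerVector

variable {H : Type v} [NormedAddCommGroup H] [InnerProductSpace ℂ H]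

/-- The vector `p Ω` of `p Ĥ`; it is `Ω` itself when `Ω ∈ p Ĥ`. -/
def cornerVector (s : H →L[ℂ] H) (Ω : HilbertTensor H H) : cornerSpace s :=
  (cornerSpace s).orthogonalProjectionOnto Ω

theorem coe_cornerVector {s : H →L[ℂ] H} {Ω : HilbertTensor H H} (h : tensorOp s s Ω = Ω) :
    (cornerVector s Ω : HilbertTensor H H) = Ω :=
  Submodule.starProjection_eq_self_iff.mpr (mem_projSpace.mpr h)

end CornerVector

section Modular

variable {E : Type u} [NormedAddCommGroup E] [InnerProductSpace ℂ E]

/-- `J T J*`, for an anti-unitary `J` and a bounded linear operator `T`. -/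
def antiConj (J : E ≃ₗᵢ⋆[ℂ] E) (T : E →L[ℂ] E) : E →L[ℂ] E :=
  (J.toContinuousLinearEquiv : E →L⋆[ℂ] E).comp
    (T.comp (J.symm.toContinuousLinearEquiv : E →L⋆[ℂ] E))

theorem antiConj_apply (J : E ≃ₗᵢ⋆[ℂ] E) (T : E →L[ℂ] E) (v : E) :
    antiConj J T v = J (T (J.symm v)) := rfl

/-- The graph of the closure of the antilinear operator `x Ω ↦ x* Ω`, `x ∈ M`. -/
def tomitaGraph [CompleteSpace E] (M : StarSubalgebra ℂ (E →L[ℂ] E)) (Ω : E) : Set (E × E) :=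
  closure {q | ∃ x ∈ M, q = (x Ω, star x Ω)}

/-- `J` is the modular conjugation of `(M, Ω)`: the closure `S` of the operator `x Ω ↦ x* Ω` has
the polar decomposition `S = J D` with the anti-unitary `J` and a positive self-adjoint (in general
unbounded) operator `D`, the square root `Δ^{1/2}` of the modular operator. Both factors of a polar
decomposition are unique. -/
def IsModularConjugation [CompleteSpace E] (M : StarSubalgebra ℂ (E →L[ℂ] E)) (Ω : E)
    (J : E ≃ₗᵢ⋆[ℂ] E) : Prop :=
  ∃ D : E →ₗ.[ℂ] E, IsSelfAdjoint D ∧ (∀ v : D.domain, 0 ≤ (⟪(v : E), D v⟫_ℂ).re) ∧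
    tomitaGraph M Ω = {q | ∃ v : D.domain, q = ((v : E), J (D v))}

end Modular

section Uniqueness

theorem continuous_rep {B : Type u} [CStarAlgebra B] {K : Type v} [NormedAddCommGroup K]
    [InnerProductSpace ℂ K] [CompleteSpace K] (S : StarSubalgebra ℂ B)
    [hS : IsClosed (S : Set B)] (σ : S →⋆ₐ[ℂ] (K →L[ℂ] K)) : Continuous σ :=
  AddMonoidHomClass.continuous_of_bound σ 1 fun x => by
    simpa using NonUnitalStarAlgHom.norm_apply_le σ x

/-- A representation of `𝒜` is determined by its values on the products `B ⊗ A`, `B ∈ 𝒜_L`,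
`A ∈ 𝒜_R`; so the representation `πHat` of a reflection-split representation is determined
by `π`. -/
theorem rep_unique {d : ℕ} {K : Type v} [NormedAddCommGroup K] [InnerProductSpace ℂ K]
    [CompleteSpace K] {ρ ρ' : AlgZ d →⋆ₐ[ℂ] (K →L[ℂ] K)}
    (h : ∀ (B : AlgL d) (A : AlgR d), ρ (inclL d B * inclR d A) = ρ' (inclL d B * inclR d A)) :
    ρ = ρ' := by
  have hcl : IsClosed (AlgZ d : Set (EllTwo (Config d) →L[ℂ] EllTwo (Config d))) :=
    StarSubalgebra.isClosed_topologicalClosure _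
  have hL : ∀ B, ρ (inclL d B) = ρ' (inclL d B) := fun B => by
    have := h B 1
    rwa [map_one, mul_one] at this
  have hR : ∀ A, ρ (inclR d A) = ρ' (inclR d A) := fun A => by
    have := h 1 A
    rwa [map_one, one_mul] at this
  have hsite : ∀ (j : ℤ) (Q : Matrix (Fin d) (Fin d) ℂ),
      ρ ⟨site d j Q, site_mem d (Set.mem_univ j) Q⟩ =
        ρ' ⟨site d j Q, site_mem d (Set.mem_univ j) Q⟩ := by
    intro j Q
    by_cases hj : j ∈ Set.Ici (0 : ℤ)
    · have e : (⟨site d j Q, site_mem d (Set.mem_univ j) Q⟩ : AlgZ d) =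
          inclR d ⟨site d j Q, site_mem d hj Q⟩ := 
            Subtype.ext (coe_inclR d ⟨site d j Q, site_mem d hj Q⟩).symm
      rw [e]
      exact hR _
    · have hj' : j ∈ Set.Iic (-1 : ℤ) := by
        simp only [Set.mem_Iic, Set.mem_Ici] at *
        omega
      have e : (⟨site d j Q, site_mem d (Set.mem_univ j) Q⟩ : AlgZ d) =
          inclL d ⟨site d j Q, site_mem d hj' Q⟩ := 
            Subtype.ext (coe_inclL d ⟨site d j Q, site_mem d hj' Q⟩).symm
      rw [e]
      exact hL _
  refine StarAlgHom.ext_topologicalClosure (continuous_rep _ ρ) (continuous_rep _ ρ') ?_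
  refine StarAlgHom.ext_adjoin ?_
  rintro ⟨x, hx⟩ ⟨j, -, Q, hQ⟩
  obtain rfl : x = site d j Q := hQ
  exact hsite j Q

end Uniqueness

end SpinChain

end

noncomputable section

open scoped TensorProduct InnerProductSpace ComplexOrder

namespace SpinChain

section HilbertTensorProduct

variable {K L E : Type*} [NormedAddCommGroup K] [InnerProductSpace ℂ K]
  [NormedAddCommGroup L] [InnerProductSpace ℂ L] [NormedAddCommGroup E] [InnerProductSpace ℂ E]

/-- The bounded bilinear map `m` exhibits `E` as a Hilbert space tensor product of `K` and `L`. -/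
structure IsHilbertTensorProduct (m : K →L[ℂ] L →L[ℂ] E) : Prop where
  inner_apply : ∀ a b a' b', ⟪m a b, m a' b'⟫_ℂ = ⟪a, a'⟫_ℂ * ⟪b, b'⟫_ℂ
  dense_span : Dense (Submodule.span ℂ (Set.range fun p : K × L => m p.1 p.2) : Set E)

namespace IsHilbertTensorProduct

variable {m : K →L[ℂ] L →L[ℂ] E}

theorem norm_apply (hm : IsHilbertTensorProduct m) (a : K) (b : L) : ‖m a b‖ = ‖a‖ * ‖b‖ := by
  have h := hm.inner_apply a b a b
  rw [inner_self_eq_norm_sq_to_K, inner_self_eq_norm_sq_to_K, inner_self_eq_norm_sq_to_K] at h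
  have h' : ‖m a b‖ ^ 2 = (‖a‖ * ‖b‖) ^ 2 := by rw [mul_pow]; exact_mod_cast h
  exact (sq_eq_sq₀ (norm_nonneg _) (by positivity)).mp h'

theorem ext {F : Type*} [NormedAddCommGroup F] [NormedSpace ℂ F] {σ : ℂ →+* ℂ}
    (hm : IsHilbertTensorProduct m) {f g : E →SL[σ] F} (h : ∀ a b, f (m a b) = g (m a b)) :
    f = g := by
  refine ContinuousLinearMap.ext_on hm.dense_span ?_
  rintro _ ⟨⟨a, b⟩, rfl⟩
  exact h a b

theorem eq_of_inner (hm : IsHilbertTensorProduct m) {x y : E}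
    (h : ∀ a b, ⟪m a b, x⟫_ℂ = ⟪m a b, y⟫_ℂ) : x = y := by
  have h2 : innerSL ℂ x = innerSL ℂ y := hm.ext fun a b => by
    simp only [innerSL_apply_apply]
    rw [← inner_conj_symm, h, inner_conj_symm]
  exact innerSL_inj.mp h2

end IsHilbertTensorProduct

variable [CompleteSpace L] [CompleteSpace E]

/-- The vector `ψ` of `K ⊗ L` as an antilinear map `T` from `K` to `L`, with
`⟪a ⊗ b, ψ⟫ = ⟪b, T a⟫`. -/
def contraction (m : K →L[ℂ] L →L[ℂ] E) (ψ : E) : K →L⋆[ℂ] L :=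
  (ContinuousLinearMap.apply ℂ L ψ).comp
    (((ContinuousLinearMap.adjoint (𝕜 := ℂ) (E := L) (F := E)).toContinuousLinearEquiv :
      (L →L[ℂ] E) →L⋆[ℂ] (E →L[ℂ] L)).comp m)

theorem contraction_apply (m : K →L[ℂ] L →L[ℂ] E) (ψ : E) (a : K) :
    contraction m ψ a = ContinuousLinearMap.adjoint (m a) ψ := rfl

theorem inner_contraction (m : K →L[ℂ] L →L[ℂ] E) (ψ : E) (a : K) (b : L) :
    ⟪b, contraction m ψ a⟫_ℂ = ⟪m a b, ψ⟫_ℂ := by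
  rw [contraction_apply, ContinuousLinearMap.adjoint_inner_right]

theorem contraction_tmul {m : K →L[ℂ] L →L[ℂ] E} (hm : IsHilbertTensorProduct m) (a a' : K)
    (b : L) : contraction m (m a' b) a = ⟪a, a'⟫_ℂ • b := by
  refine ext_inner_left ℂ fun c => ?_
  rw [inner_contraction, hm.inner_apply, inner_smul_right]

theorem contraction_add (m : K →L[ℂ] L →L[ℂ] E) (ψ φ : E) :
    contraction m (ψ + φ) = contraction m ψ + contraction m φ := by
  ext a; simp [contraction_apply]

theorem contraction_smul (m : K →L[ℂ] L →L[ℂ] E) (c : ℂ) (ψ : E) :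
    contraction m (c • ψ) = c • contraction m ψ := by
  ext a; simp [contraction_apply]

/-- A vector of the tensor product defines a Hilbert-Schmidt, hence compact, antilinear map. -/
theorem isCompactOperator_contraction {m : K →L[ℂ] L →L[ℂ] E} (hm : IsHilbertTensorProduct m)
    (ψ : E) : IsCompactOperator (contraction m ψ) := by
  let C : E →ₗ[ℂ] (K →L⋆[ℂ] L) :=
    { toFun := contraction m
      map_add' := contraction_add m
      map_smul' := contraction_smul m }
  have hC : Continuous C := by
    refine AddMonoidHomClass.continuous_of_bound C 1 fun ψ => ?_
    rw [one_mul]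
    refine ContinuousLinearMap.opNorm_le_bound _ (norm_nonneg _) fun a => ?_
    change ‖ContinuousLinearMap.adjoint (m a) ψ‖ ≤ _
    refine (ContinuousLinearMap.le_opNorm _ _).trans ?_
    rw [LinearIsometryEquiv.norm_map, mul_comm]
    refine mul_le_mul_of_nonneg_left ?_ (norm_nonneg _)
    exact ContinuousLinearMap.opNorm_le_bound _ (norm_nonneg _) fun b => (hm.norm_apply a b).le
  have hcl : IsClosed {ψ | IsCompactOperator (C ψ)} :=
    (isClosed_setOfPred_isCompactOperator (𝕜₁ := ℂ) (σ₁₂ := starRingEnd ℂ) (M₁ := K)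
      (M₂ := L)).preimage hC
  refine hm.dense_span.induction (P := fun ψ => IsCompactOperator (C ψ)) ?_ hcl ψ
  intro x hx
  induction hx using Submodule.span_induction with
  | mem x hx =>
    obtain ⟨⟨a', b⟩, rfl⟩ := hx
    have e : (C (m a' b) : K → L) = (ContinuousLinearMap.toSpanSingleton ℂ b) ∘
        (fun a => ⟪a, a'⟫_ℂ) := by
      funext a
      exact (contraction_tmul hm a a' b).trans (by simp)
    rw [e]
    have h1 : IsCompactOperator (ContinuousLinearMap.toSpanSingleton ℂ b) :=
      isCompactOperator_of_locallyCompactSpace_rng _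
    obtain ⟨S, hS, hS'⟩ := h1
    refine ⟨S, hS, ?_⟩
    have hc : Continuous fun a : K => ⟪a, a'⟫_ℂ := by fun_prop
    have := hc.tendsto 0
    simp only [inner_zero_left] at this
    exact this hS'
  | zero => simpa using isCompactOperator_zero
  | add x y _ _ hx hy => rw [map_add]; exact hx.add hy
  | smul c x _ hx => rw [map_smul]; exact hx.smul c

end HilbertTensorProduct

section ModularConjugation

theorem inner_antiunitary {E F : Type*} [NormedAddCommGroup E] [InnerProductSpace ℂ E]
    [NormedAddCommGroup F] [InnerProductSpace ℂ F] (J : E ≃ₗᵢ⋆[ℂ] F) (x y : E) :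
    ⟪J x, J y⟫_ℂ = ⟪y, x⟫_ℂ := by
  have hre : ∀ x y, RCLike.re ⟪J x, J y⟫_ℂ = RCLike.re ⟪x, y⟫_ℂ := fun x y => by
    rw [re_inner_eq_norm_add_mul_self_sub_norm_mul_self_sub_norm_mul_self_div_two,
      re_inner_eq_norm_add_mul_self_sub_norm_mul_self_sub_norm_mul_self_div_two, ← map_add,
      J.norm_map, J.norm_map, J.norm_map]
  have h1 := hre x y
  have h2 := hre (Complex.I • x) y
  rw [LinearIsometryEquiv.map_smulₛₗ, inner_smul_left, inner_smul_left] at h2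
  refine Complex.ext (h1.trans (inner_re_symm x y)) ?_
  have h3 := inner_im_symm (𝕜 := ℂ) x y
  simp at h2 h3
  linarith

variable {E : Type*} [NormedAddCommGroup E] [InnerProductSpace ℂ E] [CompleteSpace E]

/-- If `S` is the closure of `x Ω ↦ x* Ω`, `S v = w` and `S* S v = r ^ 2 v` weakly, then
`v` is an eigenvector of the modular operator, so that `S v = r J v`. -/
theorem IsModularConjugation.apply_of_eigenvector {M : StarSubalgebra ℂ (E →L[ℂ] E)} {Ω : E}
    {J : E ≃ₗᵢ⋆[ℂ] E} (hJ : IsModularConjugation M Ω J) {v w : E} {r : ℝ} (hr : 0 < r)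
    (hvw : (v, w) ∈ tomitaGraph M Ω)
    (h : ∀ x ∈ M, ⟪star x Ω, w⟫_ℂ = (r : ℂ) ^ 2 * ⟪v, x Ω⟫_ℂ) : w = (r : ℂ) • J v := by
  obtain ⟨D, hD, hpos, hG⟩ := hJ
  have hsym : ∀ a b, ⟪J.symm a, J.symm b⟫_ℂ = ⟪b, a⟫_ℂ := fun a b => by
    simpa using (inner_antiunitary J (J.symm b) (J.symm a)).symm
  have hall : ∀ q ∈ tomitaGraph M Ω, ⟪q.2, w⟫_ℂ = (r : ℂ) ^ 2 * ⟪v, q.1⟫_ℂ := by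
    have hcl : IsClosed {q : E × E | ⟪q.2, w⟫_ℂ = (r : ℂ) ^ 2 * ⟪v, q.1⟫_ℂ} :=
      isClosed_eq (by fun_prop) (by fun_prop)
    refine closure_minimal ?_ hcl
    rintro _ ⟨x, hx, rfl⟩
    exact h x hx
  rw [hG] at hvw
  obtain ⟨v, hv⟩ := hvw
  obtain ⟨rfl, rfl⟩ := Prod.mk.inj hv
  have hadj : ∀ x : D.domain, ⟪((r : ℂ) ^ 2) • (v : E), (x : E)⟫_ℂ = ⟪D v, D x⟫_ℂ := by
    intro x
    have := hall (x, J (D x)) (by rw [hG]; exact ⟨x, rfl⟩)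
    have h2 := hsym (J (D v)) (J (D x))
    simp only [LinearIsometryEquiv.symm_apply_apply] at h2
    rw [h2, this, inner_smul_left]
    simp
  have hdense := hD.dense_domain
  have hmem : D v ∈ D.adjoint.domain := LinearPMap.mem_adjoint_domain_of_exists _ ⟨_, hadj⟩
  have hval : D.adjoint ⟨D v, hmem⟩ = ((r : ℂ) ^ 2) • (v : E) :=
    LinearPMap.adjoint_apply_eq hdense _ hadj
  have hmem' : D v ∈ D.domain := by
    have := hD; rw [LinearPMap.isSelfAdjoint_def] at this; rwa [this] at hmem
  have hval' : D ⟨D v, hmem'⟩ = ((r : ℂ) ^ 2) • (v : E) := by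
    rw [← hval]
    have := hD
    rw [LinearPMap.isSelfAdjoint_def] at this
    exact ((LinearPMap.ext_iff.mp this).2 (hf := hmem) (hg := hmem')).symm
  let z : D.domain := ⟨D v, hmem'⟩ - (r : ℂ) • v
  have hDz : D z = -(r : ℂ) • (z : E) := by
    change D (⟨D v, hmem'⟩ - (r : ℂ) • v) = -(r : ℂ) • (D v - (r : ℂ) • (v : E))
    rw [LinearPMap.map_sub, LinearPMap.map_smul, hval']
    module
  have hz : (z : E) = 0 := by
    have := hpos z
    rw [hDz, inner_smul_right, inner_self_eq_norm_sq_to_K] at this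
    have h2 : 0 ≤ -r * ‖(z : E)‖ ^ 2 := by
      convert this using 1
      simp [← Complex.ofReal_pow]
    have : ‖(z : E)‖ ^ 2 ≤ 0 := by
      by_contra hcon
      push Not at hcon
      nlinarith
    exact norm_eq_zero.mp (pow_eq_zero_iff two_ne_zero |>.mp (le_antisymm this (by positivity)))
  have hDv : D v = (r : ℂ) • (v : E) := sub_eq_zero.mp hz
  rw [hDv, LinearIsometryEquiv.map_smulₛₗ]
  simp

end ModularConjugation

section SchmidtVector

variable {K : Type*} [NormedAddCommGroup K] [InnerProductSpace ℂ K] {κ : ℂ}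

theorem conj_sign (hκ : κ = 1 ∨ κ = -1) : (starRingEnd ℂ) κ = κ := by
  rcases hκ with rfl | rfl <;> simp

theorem sign_mul_self (hκ : κ = 1 ∨ κ = -1) : κ * κ = 1 := by
  rcases hκ with rfl | rfl <;> simp

/-- `a` is an eigenvector of `κ T ^ 2` with the eigenvalue `t ^ 2`, where `t > 0`. -/
def IsSchmidtVector (κ : ℂ) (T : K →L⋆[ℂ] K) (t : ℝ) (a : K) : Prop :=
  0 < t ∧ T (T a) = (κ * (t : ℂ) ^ 2) • a

theorem IsSchmidtVector.partner (hκ : κ = 1 ∨ κ = -1) {T : K →L⋆[ℂ] K} {t : ℝ} {a : K}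
    (h : IsSchmidtVector κ T t a) : IsSchmidtVector κ T t ((t : ℂ)⁻¹ • T a) := by
  refine ⟨h.1, ?_⟩
  rw [map_smulₛₗ, map_smulₛₗ, h.2, map_smulₛₗ]
  simp only [map_inv₀, map_mul, map_pow, Complex.conj_ofReal, conj_sign hκ]
  module

end SchmidtVector

section SymmetricVector

variable {K E : Type*} [NormedAddCommGroup K] [InnerProductSpace ℂ K] [CompleteSpace K]
  [NormedAddCommGroup E] [InnerProductSpace ℂ E] [CompleteSpace E]
  {m : K →L[ℂ] K →L[ℂ] E} {Ω : E} {κ : ℂ}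

theorem inner_contraction_symm (hsym : ∀ a b, ⟪m a b, Ω⟫_ℂ = κ * ⟪m b a, Ω⟫_ℂ) (a b : K) :
    ⟪a, contraction m Ω b⟫_ℂ = κ * ⟪b, contraction m Ω a⟫_ℂ := by
  rw [inner_contraction, inner_contraction, hsym]

theorem dense_span_isSchmidtVector (hm : IsHilbertTensorProduct m) (hκ : κ = 1 ∨ κ = -1)
    (hsym : ∀ a b, ⟪m a b, Ω⟫_ℂ = κ * ⟪m b a, Ω⟫_ℂ)
    (hinj : ∀ a, contraction m Ω a = 0 → a = 0) :
    Dense (Submodule.span ℂ {a | ∃ t, IsSchmidtVector κ (contraction m Ω) t a} : Set K) := by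
  set T := contraction m Ω with hT
  let A : K →L[ℂ] K := κ • T.comp T
  have hAinner : ∀ a b, ⟪a, A b⟫_ℂ = ⟪T b, T a⟫_ℂ := fun a b => by
    change ⟪a, κ • T (T b)⟫_ℂ = _
    rw [inner_smul_right, inner_contraction_symm hsym, ← mul_assoc, sign_mul_self hκ, one_mul]
  have hAsymm : A.IsSymmetric := fun a b => by
    change ⟪A a, b⟫_ℂ = ⟪a, A b⟫_ℂ
    rw [hAinner, ← inner_conj_symm, hAinner, inner_conj_symm]
  have hAcomp : IsCompactOperator A :=
    ((isCompactOperator_contraction hm Ω).comp_clm T).smul κ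
  have horth := ContinuousLinearMap.orthogonalComplement_iSup_eigenspaces_eq_bot hAcomp hAsymm
  rw [Submodule.dense_iff_topologicalClosure_eq_top, Submodule.topologicalClosure_eq_top_iff,
    eq_bot_iff, ← horth]
  refine Submodule.orthogonal_le (iSup_le fun μ a ha => ?_)
  have ha : A a = μ • a := Module.End.mem_eigenspace_iff.mp ha
  by_cases h0 : a = 0
  · rw [h0]; exact Submodule.zero_mem _
  have hna : 0 < ‖a‖ := norm_pos_iff.mpr h0
  have hnT : 0 < ‖T a‖ := norm_pos_iff.mpr fun h => h0 (hinj a h)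
  refine Submodule.subset_span ⟨‖T a‖ / ‖a‖, by positivity, ?_⟩
  have h1 := hAinner a a
  rw [ha, inner_smul_right, inner_self_eq_norm_sq_to_K, inner_self_eq_norm_sq_to_K] at h1
  have hμ : μ = ((‖T a‖ / ‖a‖ : ℝ) : ℂ) ^ 2 := by
    have : (‖a‖ : ℂ) ≠ 0 := by exact_mod_cast hna.ne'
    push_cast
    rw [div_pow, eq_div_iff (pow_ne_zero 2 this)]
    exact h1
  have h2 : κ • T (T a) = μ • a := ha
  rw [← hμ, mul_smul, ← h2, smul_smul, sign_mul_self hκ, one_smul]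

variable {R : (K →L[ℂ] K) →⋆ₐ[ℂ] (E →L[ℂ] E)}

theorem inner_apply_vector (hR : ∀ x a b, R x (m a b) = m a (x b)) (x : K →L[ℂ] K) (a b : K) :
    ⟪m a b, R x Ω⟫_ℂ = ⟪b, x (contraction m Ω a)⟫_ℂ := by
  rw [← ContinuousLinearMap.adjoint_inner_left, ← ContinuousLinearMap.star_eq_adjoint, ← map_star,
    hR, ← inner_contraction, ContinuousLinearMap.star_eq_adjoint,
    ContinuousLinearMap.adjoint_inner_left]

theorem rankOne_apply_vector (hm : IsHilbertTensorProduct m)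
    (hR : ∀ x a b, R x (m a b) = m a (x b))
    (hsym : ∀ a b, ⟪m a b, Ω⟫_ℂ = κ * ⟪m b a, Ω⟫_ℂ) (b c : K) :
    R (InnerProductSpace.rankOne ℂ b c) Ω = κ • m (contraction m Ω c) b := by
  refine hm.eq_of_inner fun a a' => ?_
  rw [inner_apply_vector hR, InnerProductSpace.rankOne_apply, inner_smul_right, inner_smul_right,
    hm.inner_apply, inner_contraction_symm hsym]
  ring

theorem modularConjugation_schmidt (hm : IsHilbertTensorProduct m) (hκ : κ = 1 ∨ κ = -1)
    (hR : ∀ x a b, R x (m a b) = m a (x b))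
    (hsym : ∀ a b, ⟪m a b, Ω⟫_ℂ = κ * ⟪m b a, Ω⟫_ℂ) {J : E ≃ₗᵢ⋆[ℂ] E}
    (hJ : IsModularConjugation (StarAlgHom.range R) Ω J) {a b : K} {t r : ℝ}
    (ha : IsSchmidtVector κ (contraction m Ω) t a) (hb : IsSchmidtVector κ (contraction m Ω) r b) :
    J (m a b) = κ • m ((r : ℂ)⁻¹ • contraction m Ω b) ((t : ℂ)⁻¹ • contraction m Ω a) := by
  obtain ⟨ht, ha⟩ := ha
  obtain ⟨hr, hb⟩ := hb
  have htC : (t : ℂ) ≠ 0 := by exact_mod_cast ht.ne'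
  have hrC : (r : ℂ) ≠ 0 := by exact_mod_cast hr.ne'
  set T := contraction m Ω with hT
  let c : K := (κ * ((t : ℂ) ^ 2)⁻¹) • T a
  have hc : T c = a := by
    change T ((κ * ((t : ℂ) ^ 2)⁻¹) • T a) = a
    rw [map_smulₛₗ, ha, smul_smul]
    simp only [map_mul, map_inv₀, map_pow, Complex.conj_ofReal, conj_sign hκ]
    convert one_smul ℂ a using 2
    field_simp
    rw [sq, sign_mul_self hκ]
  have hTTc : T (T c) = (κ * (t : ℂ) ^ 2) • c := by
    rw [hc]
    change T a = (κ * (t : ℂ) ^ 2) • (κ * ((t : ℂ) ^ 2)⁻¹) • T a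
    rw [smul_smul]
    convert (one_smul ℂ (T a)).symm using 2
    field_simp
    rw [sq, sign_mul_self hκ]
  have hgraph : (m a b, m (T b) c) ∈ tomitaGraph (StarAlgHom.range R) Ω := by
    refine subset_closure ⟨R (InnerProductSpace.rankOne ℂ (κ • b) c), ⟨_, rfl⟩, ?_⟩
    rw [← map_star, ContinuousLinearMap.star_eq_adjoint, InnerProductSpace.adjoint_rankOne,
      rankOne_apply_vector hm hR hsym, rankOne_apply_vector hm hR hsym, ← hT, hc,
      map_smulₛₗ T κ b, (m a).map_smul κ b, m.map_smul, conj_sign hκ, smul_apply, smul_smul,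
      smul_smul, sign_mul_self hκ, one_smul, one_smul]
  have hmod := hJ.apply_of_eigenvector (r := r / t) (by positivity) hgraph (by
    rintro _ ⟨y, rfl⟩
    change ⟪star (R y) Ω, _⟫_ℂ = _ * ⟪_, R y Ω⟫_ℂ
    rw [← map_star, ← inner_conj_symm, inner_apply_vector hR, inner_apply_vector hR, ← hT, hb,
      ← hc, hTTc, map_smul, map_smul, inner_smul_right, inner_smul_right,
      ContinuousLinearMap.star_eq_adjoint, ContinuousLinearMap.adjoint_inner_right, map_mul,
      inner_conj_symm]
    simp only [map_mul, map_pow, Complex.conj_ofReal, conj_sign hκ]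
    push_cast
    field_simp)
  have : J (m a b) = (((r / t : ℝ) : ℂ)⁻¹) • m (T b) c := by
    rw [hmod, smul_smul, inv_mul_cancel₀, one_smul]
    exact_mod_cast (div_pos hr ht).ne'
  rw [this]
  simp only [c, map_smul, smul_apply, smul_smul]
  congr 1
  push_cast
  field_simp

/-- The modular conjugation of a vector `Ω` which is symmetric or antisymmetric under the flip is
a tensor product of two antiunitaries, composed with the flip. -/
theorem exists_antiunitary_modularConjugation [Nontrivial K] (hm : IsHilbertTensorProduct m)
    (hκ : κ = 1 ∨ κ = -1) (hR : ∀ x a b, R x (m a b) = m a (x b))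
    (hsym : ∀ a b, ⟪m a b, Ω⟫_ℂ = κ * ⟪m b a, Ω⟫_ℂ)
    (hinj : ∀ a, contraction m Ω a = 0 → a = 0) {J : E ≃ₗᵢ⋆[ℂ] E}
    (hJ : IsModularConjugation (StarAlgHom.range R) Ω J) :
    ∃ θ : K ≃ₗᵢ⋆[ℂ] K, (∀ a, θ (θ a) = κ • a) ∧ ∀ a b, J (m a b) = κ • m (θ b) (θ a) := by
  have hdense := dense_span_isSchmidtVector hm hκ hsym hinj
  have hJm := @modularConjugation_schmidt _ _ _ _ _ _ _ _ m Ω κ R hm hκ hR hsym J hJ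
  set T := contraction m Ω with hT
  have hnormκ : ‖κ‖ = 1 := by rcases hκ with rfl | rfl <;> simp
  obtain ⟨e, n, he, he0⟩ : ∃ e n, IsSchmidtVector κ T n e ∧ e ≠ 0 := by
    by_contra! hcon
    have hbot : Submodule.span ℂ {a | ∃ t, IsSchmidtVector κ T t a} = ⊥ := by
      rw [Submodule.span_eq_bot]
      rintro a ⟨t, ht⟩
      exact hcon a t ht
    rw [hbot, Submodule.dense_iff_topologicalClosure_eq_top,
      (Submodule.closed_of_finiteDimensional _).submodule_topologicalClosure_eq] at hdense
    exact bot_ne_top hdense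
  have hne : ‖e‖ ≠ 0 := norm_ne_zero_iff.mpr he0
  let f : K := (n : ℂ)⁻¹ • T e
  have hf : ‖f‖ = ‖e‖ := by
    have h := congrArg norm (hJm he he)
    rw [J.norm_map, norm_smul, hnormκ, one_mul, hm.norm_apply, hm.norm_apply] at h
    exact ((mul_self_eq_mul_self_iff.mp h).resolve_right fun h => by
      have := norm_nonneg f
      have := norm_pos_iff.mpr he0
      change ‖e‖ = -‖f‖ at h
      linarith).symm
  let θ₀ : K →L⋆[ℂ] K := (κ * ((‖e‖ : ℂ) ^ 2)⁻¹) • (ContinuousLinearMap.adjoint (m f)).comp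
    ((J.toContinuousLinearEquiv : E →L⋆[ℂ] E).comp (m.flip e))
  have hθ₀ : ∀ a t, IsSchmidtVector κ T t a → θ₀ a = (t : ℂ)⁻¹ • T a := fun a t ha => by
    change (κ * ((‖e‖ : ℂ) ^ 2)⁻¹) • ContinuousLinearMap.adjoint (m f) (J (m a e)) = _
    rw [hJm ha he, ← contraction_apply, contraction_smul, smul_apply, contraction_tmul hm,
      inner_self_eq_norm_sq_to_K, hf, smul_smul, smul_smul]
    have : (‖e‖ : ℂ) ≠ 0 := by exact_mod_cast hne
    convert one_smul ℂ ((t : ℂ)⁻¹ • T a) using 2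
    field_simp
    rw [sq, sign_mul_self hκ]
    simp
  have hsq : ∀ a, θ₀ (θ₀ a) = κ • a := by
    have : θ₀.comp θ₀ = κ • ContinuousLinearMap.id ℂ K := by
      refine ContinuousLinearMap.ext_on hdense ?_
      rintro a ⟨t, ha⟩
      change θ₀ (θ₀ a) = κ • a
      have htC : (t : ℂ) ≠ 0 := by exact_mod_cast ha.1.ne'
      rw [hθ₀ a t ha, hθ₀ _ t (ha.partner hκ), map_smulₛₗ, ha.2, smul_smul, smul_smul]
      simp only [map_inv₀, Complex.conj_ofReal]
      congr 1
      field_simp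
    exact fun a => DFunLike.congr_fun this a
  have hJθ : ∀ a b, J (m a b) = κ • m (θ₀ b) (θ₀ a) := by
    have h1 : ∀ b r, IsSchmidtVector κ T r b → ∀ a, J (m a b) = κ • m (θ₀ b) (θ₀ a) := by
      intro b r hb a
      have : (J.toContinuousLinearEquiv : E →L⋆[ℂ] E).comp (m.flip b) =
          κ • (m (θ₀ b)).comp θ₀ := by
        refine ContinuousLinearMap.ext_on hdense ?_
        rintro a ⟨t, ha⟩
        change J (m a b) = κ • m (θ₀ b) (θ₀ a)
        rw [hJm ha hb, hθ₀ a t ha, hθ₀ b r hb]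
      exact DFunLike.congr_fun this a
    intro a b
    have : (J.toContinuousLinearEquiv : E →L⋆[ℂ] E).comp (m a) =
        κ • (m.flip (θ₀ a)).comp θ₀ := by
      refine ContinuousLinearMap.ext_on hdense ?_
      rintro b ⟨r, hb⟩
      exact h1 b r hb a
    exact DFunLike.congr_fun this b
  have hnorm : ∀ a, ‖θ₀ a‖ = ‖a‖ := by
    intro a
    have h := congrArg norm (hJθ a e)
    rw [J.norm_map, norm_smul, hnormκ, one_mul, hm.norm_apply, hm.norm_apply, hθ₀ e n he] at h
    change ‖a‖ * ‖e‖ = ‖f‖ * _ at h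
    rw [hf, mul_comm] at h
    exact (mul_left_cancel₀ hne h).symm
  refine ⟨⟨{ (θ₀ : K →ₗ⋆[ℂ] K) with
    invFun := fun a => κ • θ₀ a
    left_inv := fun a => ?_
    right_inv := fun a => ?_ }, hnorm⟩, hsq, hJθ⟩
  · change κ • θ₀ (θ₀ a) = a
    rw [hsq, smul_smul, sign_mul_self hκ, one_smul]
  · change θ₀ (κ • θ₀ a) = a
    rw [map_smulₛₗ, hsq, conj_sign hκ, smul_smul, sign_mul_self hκ, one_smul]

end SymmetricVector

section Tmul

variable {E F : Type*} [NormedAddCommGroup E] [InnerProductSpace ℂ E]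
  [NormedAddCommGroup F] [InnerProductSpace ℂ F]

/-- `(ξ, η) ↦ ξ ⊗ η` as a bounded bilinear map into the Hilbert space tensor product. -/
def tmulL (E F : Type*) [NormedAddCommGroup E] [InnerProductSpace ℂ E]
    [NormedAddCommGroup F] [InnerProductSpace ℂ F] : E →L[ℂ] F →L[ℂ] HilbertTensor E F :=
  LinearMap.mkContinuous₂ ((TensorProduct.mk ℂ E F).compr₂
    (UniformSpace.Completion.toComplL : (E ⊗[ℂ] F) →L[ℂ] HilbertTensor E F).toLinearMap) 1
    fun ξ η => by simp

theorem tmulL_apply (ξ : E) (η : F) :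
    tmulL E F ξ η = ((ξ ⊗ₜ[ℂ] η : E ⊗[ℂ] F) : HilbertTensor E F) := rfl

theorem tensorOp_tmulL (a : E →L[ℂ] E) (b : F →L[ℂ] F) (ξ : E) (η : F) :
    tensorOp a b (tmulL E F ξ η) = tmulL E F (a ξ) (b η) := tensorOp_tmul a b ξ η

theorem isHilbertTensorProduct_tmulL : IsHilbertTensorProduct (tmulL E F) where
  inner_apply a b a' b' := by
    rw [tmulL_apply, tmulL_apply, UniformSpace.Completion.inner_coe, TensorProduct.inner_tmul]
  dense_span := by
    have hd : DenseRange ((↑) : E ⊗[ℂ] F → HilbertTensor E F) :=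
      UniformSpace.Completion.denseRange_coe
    refine hd.mono ?_
    rintro _ ⟨x, rfl⟩
    induction x using TensorProduct.induction_on with
    | zero => rw [UniformSpace.Completion.coe_zero]; exact Submodule.zero_mem _
    | tmul ξ η => exact Submodule.subset_span ⟨(ξ, η), rfl⟩
    | add x y hx hy => rw [UniformSpace.Completion.coe_add]; exact Submodule.add_mem _ hx hy

/-- The flip `ξ ⊗ η ↦ η ⊗ ξ`. -/
def flip (E : Type*) [NormedAddCommGroup E] [InnerProductSpace ℂ E] :
    HilbertTensor E E →L[ℂ] HilbertTensor E E :=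
  (TensorProduct.commIsometry ℂ E E).toContinuousLinearEquiv.toContinuousLinearMap.completion

theorem flip_tmulL (ξ η : E) : flip E (tmulL E E ξ η) = tmulL E E η ξ := by
  simp [flip, tmulL_apply]

theorem flip_flip (ψ : HilbertTensor E E) : flip E (flip E ψ) = ψ := by
  have h : (flip E).comp (flip E) = ContinuousLinearMap.id ℂ _ :=
    isHilbertTensorProduct_tmulL.ext fun a b => by
      simp only [ContinuousLinearMap.comp_apply, flip_tmulL, ContinuousLinearMap.id_apply]
  exact DFunLike.congr_fun h ψ

theorem inner_tmulL_flip (ξ η : E) (ψ : HilbertTensor E E) :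
    ⟪tmulL E E ξ η, flip E ψ⟫_ℂ = ⟪tmulL E E η ξ, ψ⟫_ℂ := by
  have h : (innerSL ℂ (tmulL E E ξ η)).comp (flip E) = innerSL ℂ (tmulL E E η ξ) :=
    isHilbertTensorProduct_tmulL.ext fun a b => by
      simp only [ContinuousLinearMap.comp_apply, flip_tmulL, innerSL_apply_apply,
        isHilbertTensorProduct_tmulL.inner_apply]
      ring
  exact DFunLike.congr_fun h ψ

theorem flip_tensorOp (a b : E →L[ℂ] E) (ψ : HilbertTensor E E) :
    flip E (tensorOp a b ψ) = tensorOp b a (flip E ψ) := by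
  have h : (flip E).comp (tensorOp a b) = (tensorOp b a).comp (flip E) :=
    isHilbertTensorProduct_tmulL.ext fun ξ η => by
      simp only [ContinuousLinearMap.comp_apply, flip_tmulL, tensorOp_tmulL]
  exact DFunLike.congr_fun h ψ

theorem inner_tmulL_tensorOp [CompleteSpace E] [CompleteSpace F] (a : E →L[ℂ] E) (b : F →L[ℂ] F)
    (ξ : E) (η : F) (ψ : HilbertTensor E F) :
    ⟪tmulL E F ξ η, tensorOp a b ψ⟫_ℂ = ⟪tmulL E F (star a ξ) (star b η), ψ⟫_ℂ := by
  rw [← tensorOp_tmulL, ← star_tensorOp, ContinuousLinearMap.star_eq_adjoint,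
    ContinuousLinearMap.adjoint_inner_left]

end Tmul

section Schur

variable {A : Type*} [Ring A] [StarRing A] [Algebra ℂ A]
  {H : Type*} [NormedAddCommGroup H] [InnerProductSpace ℂ H] [CompleteSpace H]
  {π : A →⋆ₐ[ℂ] (H →L[ℂ] H)}

theorem IsIrreducibleRep.eq_zero_or_injective (hπ : IsIrreducibleRep π) {T : H →L[ℂ] H}
    (hT : ∀ a, Commute T (π a)) : T = 0 ∨ ∀ v, T v = 0 → v = 0 := by
  rcases hπ.2 (LinearMap.ker (T : H →ₗ[ℂ] H)) T.isClosed_ker (fun a v hv => by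
    rw [LinearMap.mem_ker] at hv ⊢
    have := DFunLike.congr_fun (hT a).eq v
    change T (π a v) = π a (T v) at this
    change T (π a v) = 0
    rw [this]
    rw [show T v = 0 from hv, map_zero]) with h | h
  · right
    intro v hv
    have : v ∈ LinearMap.ker (T : H →ₗ[ℂ] H) := hv
    rwa [h, Submodule.mem_bot] at this
  · left
    ext v
    have : v ∈ LinearMap.ker (T : H →ₗ[ℂ] H) := by rw [h]; trivial
    exact this

theorem IsIrreducibleRep.spectrum_subsingleton (hπ : IsIrreducibleRep π) {S : H →L[ℂ] H}
    (hS : IsSelfAdjoint S) (hc : ∀ a, Commute S (π a)) : (spectrum ℝ S).Subsingleton := by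
  have key : ∀ c ∈ spectrum ℝ S, ∀ c' ∈ spectrum ℝ S, ¬ c < c' := by
    intro c hcS c' hcS' hlt
    let f : ℝ → ℝ := fun x => max (x - (c + c') / 2) 0
    let g : ℝ → ℝ := fun x => max ((c + c') / 2 - x) 0
    have hfg : cfc f S * cfc g S = 0 := by
      rw [← cfc_mul f g S (by fun_prop) (by fun_prop), ← cfc_zero ℝ S]
      congr 1
      funext x
      rcases le_total x ((c + c') / 2) with h | h
      · simp [f, h]
      · simp [g, h]
    have h0 : ∀ k : ℝ → ℝ, ContinuousOn k (spectrum ℝ S) → cfc k S = 0 →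
        ∀ x ∈ spectrum ℝ S, k x = 0 := by
      intro k hk hk0
      rw [← cfc_zero ℝ S] at hk0
      exact eqOn_of_cfc_eq_cfc hk0
    rcases hπ.eq_zero_or_injective (T := cfc f S) (fun a => (hc a).cfc_real f) with h | h
    · have := h0 f (by fun_prop) h c' hcS'
      have := le_max_left (c' - (c + c') / 2) 0
      simp only [f] at *
      linarith
    · have hg : cfc g S = 0 := by
        ext v
        exact h _ (DFunLike.congr_fun hfg v)
      have := h0 g (by fun_prop) hg c hcS
      have := le_max_left ((c + c') / 2 - c) 0
      simp only [g] at *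
      linarith
  intro c hcS c' hcS'
  exact le_antisymm (not_lt.mp (key c' hcS' c hcS)) (not_lt.mp (key c hcS c' hcS'))

theorem IsIrreducibleRep.selfAdjoint_scalar (hπ : IsIrreducibleRep π) {S : H →L[ℂ] H}
    (hS : IsSelfAdjoint S) (hc : ∀ a, Commute S (π a)) : ∃ c : ℂ, S = c • 1 := by
  have := hπ.1
  obtain ⟨c, hcS⟩ : (spectrum ℝ S).Nonempty := ContinuousFunctionalCalculus.spectrum_nonempty S hS
  refine ⟨c, ?_⟩
  have h : cfc (id : ℝ → ℝ) S = cfc (fun _ : ℝ => c) S :=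
    cfc_congr fun x hx => hπ.spectrum_subsingleton hS hc hx hcS
  rw [cfc_id ℝ S, cfc_const c S] at h
  rw [h, Algebra.algebraMap_eq_smul_one]
  ext v
  simp

/-- **Schur's lemma**: the commutant of an irreducible representation is trivial. -/
theorem IsIrreducibleRep.scalar_of_commute (hπ : IsIrreducibleRep π) {T : H →L[ℂ] H}
    (hT : ∀ a, Commute T (π a)) : ∃ c : ℂ, T = c • 1 := by
  have hT' : ∀ a, Commute (star T) (π a) := fun a => by
    have := (hT (star a)).star_star
    rwa [map_star, star_star] at this
  obtain ⟨c, hc⟩ := hπ.selfAdjoint_scalar (S := T + star T) (IsSelfAdjoint.add_star_self T)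
    fun a => (hT a).add_left (hT' a)
  obtain ⟨c', hc'⟩ := hπ.selfAdjoint_scalar (S := Complex.I • (T - star T)) (by
      rw [IsSelfAdjoint, star_smul, star_sub, star_star]
      simp only [RCLike.star_def, Complex.conj_I]
      module)
    fun a => ((hT a).sub_left (hT' a)).smul_left _
  refine ⟨(c - Complex.I * c') / 2, ?_⟩
  have h : T = (2 : ℂ)⁻¹ • ((T + star T) - Complex.I • (Complex.I • (T - star T))) := by
    rw [smul_smul, Complex.I_mul_I]
    module
  rw [h, hc, hc']
  module

variable {E : Type*} [NormedAddCommGroup E] [InnerProductSpace ℂ E] [CompleteSpace E]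

theorem IsIrreducibleRep.exists_inner_eq (hπ : IsIrreducibleRep π) {L : Type*}
    [NormedAddCommGroup L] [InnerProductSpace ℂ L] {m : L →L[ℂ] H →L[ℂ] E}
    {P : A → E →L[ℂ] E} (hP : ∀ a ξ η, P a (m ξ η) = m ξ (π a η))
    (hstar : ∀ a, star (P a) = P (star a)) {U : E →L[ℂ] E} (hU : ∀ a, Commute U (P a)) (ξ' ξ : L) :
    ∃ c : ℂ, ∀ η' η, ⟪m ξ' η', U (m ξ η)⟫_ℂ = c * ⟪η', η⟫_ℂ := by
  obtain ⟨c, hc⟩ := hπ.scalar_of_commute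
    (T := (ContinuousLinearMap.adjoint (m ξ')).comp (U.comp (m ξ))) (fun a => by
      ext η
      refine ext_inner_left ℂ fun η' => ?_
      change ⟪η', ContinuousLinearMap.adjoint (m ξ') (U (m ξ (π a η)))⟫_ℂ =
        ⟪η', π a (ContinuousLinearMap.adjoint (m ξ') (U (m ξ η)))⟫_ℂ
      have h1 : U (m ξ (π a η)) = P a (U (m ξ η)) := by
        rw [← hP]; exact DFunLike.congr_fun (hU a).eq _
      rw [ContinuousLinearMap.adjoint_inner_right, h1,
        ← ContinuousLinearMap.adjoint_inner_left (π a), ContinuousLinearMap.adjoint_inner_right,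
        ← ContinuousLinearMap.adjoint_inner_left (P a), ← ContinuousLinearMap.star_eq_adjoint,
        ← ContinuousLinearMap.star_eq_adjoint, hstar, hP, ← map_star])
  refine ⟨c, fun η' η => ?_⟩
  rw [← ContinuousLinearMap.adjoint_inner_right]
  have := DFunLike.congr_fun hc η
  change ContinuousLinearMap.adjoint (m ξ') (U (m ξ η)) = c • η at this
  rw [this, inner_smul_right]

/-- The tensor square of an irreducible representation has a trivial commutant. -/
theorem IsIrreducibleRep.tensor_scalar_of_commute (hπ : IsIrreducibleRep π)
    {U : HilbertTensor H H →L[ℂ] HilbertTensor H H}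
    (hU : ∀ a b, Commute U (tensorOp (π a) (π b))) : ∃ c : ℂ, ∀ ψ, U ψ = c • ψ := by
  have hr := hπ.exists_inner_eq (m := tmulL H H) (P := fun a => tensorOp 1 (π a))
    (fun a ξ η => by simp only [tensorOp_tmulL, one_apply_eq_self])
    (fun a => by rw [star_tensorOp, star_one, map_star])
    (fun a => by rw [← map_one π]; exact hU 1 a)
  have hl := hπ.exists_inner_eq (m := (tmulL H H).flip) (P := fun a => tensorOp (π a) 1)
    (fun a ξ η => by
      simp only [ContinuousLinearMap.flip_apply, tensorOp_tmulL, one_apply_eq_self])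
    (fun a => by rw [star_tensorOp, star_one, map_star])
    (fun a => by rw [← map_one π]; exact hU a 1)
  have := hπ.1
  obtain ⟨e, he⟩ := exists_norm_eq H zero_le_one
  obtain ⟨d, hd⟩ := hl e e
  have hee : ⟪e, e⟫_ℂ = 1 := by rw [inner_self_eq_norm_sq_to_K, he]; simp
  refine ⟨d, fun ψ => ?_⟩
  have h : U = d • ContinuousLinearMap.id ℂ _ := by
    refine isHilbertTensorProduct_tmulL.ext fun ξ η =>
      isHilbertTensorProduct_tmulL.eq_of_inner fun ξ' η' => ?_
    obtain ⟨c, hc⟩ := hr ξ' ξ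
    have h1 := hc e e
    have h2 := hd ξ' ξ
    simp only [ContinuousLinearMap.flip_apply] at h2
    rw [hc, smul_apply, ContinuousLinearMap.id_apply, inner_smul_right,
      isHilbertTensorProduct_tmulL.inner_apply, ← mul_assoc, ← h2, h1, hee, mul_one]
  exact DFunLike.congr_fun h ψ

end Schur

section Flip

theorem reflection_reflection {d : ℕ} (A : AlgZ d) : reflection d (reflection d A) = A :=
  Subtype.ext (by rw [coe_reflection, coe_reflection, reflectOp_reflectOp])

variable {d : ℕ} {ω : AlgZ d →ₗ[ℂ] ℂ} {H : Type*} [NormedAddCommGroup H] [InnerProductSpace ℂ H]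
  [CompleteSpace H]

theorem ReflectionSplitRep.Γ_Ω (R : ReflectionSplitRep ω H) : R.Γ R.Ω = R.Ω := by
  have := R.Γ_apply 1
  rwa [map_one, map_one, map_one, one_apply_eq_self] at this

theorem ReflectionSplitRep.Γ_πHat (R : ReflectionSplitRep ω H) (A : AlgZ d)
    (ψ : HilbertTensor H H) : R.Γ (R.πHat A ψ) = R.πHat (reflection d A) (R.Γ ψ) := by
  have h : (fun ψ => R.Γ (R.πHat A ψ)) = fun ψ => R.πHat (reflection d A) (R.Γ ψ) := by
    refine R.gns.2.equalizer (by fun_prop) (by fun_prop) (funext fun B => ?_)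
    have hB := R.Γ_apply (A * B)
    rw [map_mul, map_mul, map_mul] at hB
    change R.Γ (R.πHat A (R.πHat B R.Ω)) = R.πHat (reflection d A) (R.Γ (R.πHat B R.Ω))
    rw [R.Γ_apply]
    exact hB
  exact congrFun h ψ

theorem ReflectionSplitRep.πHat_inclL (R : ReflectionSplitRep ω H) (B : AlgL d) :
    R.πHat (inclL d B) = tensorOp (R.π (reflectLR d B)) 1 := by
  have := R.πHat_apply B 1
  rwa [map_one, mul_one, map_one] at this

theorem ReflectionSplitRep.πHat_inclR (R : ReflectionSplitRep ω H) (A : AlgR d) :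
    R.πHat (inclR d A) = tensorOp 1 (R.π A) := by
  have := R.πHat_apply 1 A
  rwa [map_one, one_mul, map_one, map_one] at this

/-- The vector of a reflection-split representation is symmetric or antisymmetric under the
flip of the tensor factors. -/
theorem ReflectionSplitRep.exists_flip_eq (R : ReflectionSplitRep ω H) :
    ∃ κ : ℂ, (κ = 1 ∨ κ = -1) ∧ flip H R.Ω = κ • R.Ω := by
  obtain ⟨κ, hκ⟩ := R.irreducible.tensor_scalar_of_commute
    (U := (flip H).comp (R.Γ.toContinuousLinearEquiv : HilbertTensor H H →L[ℂ] HilbertTensor H H))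
    (fun a b => by
      obtain ⟨B, rfl⟩ : ∃ B, reflectLR d B = a := (reflectLR d).surjective a
      obtain ⟨B', rfl⟩ : ∃ B', reflectLR d B' = b := (reflectLR d).surjective b
      ext1 ψ
      change flip H (R.Γ (tensorOp _ _ ψ)) = tensorOp _ _ (flip H (R.Γ ψ))
      rw [← R.πHat_apply, R.Γ_πHat, map_mul, ← reflection_inclL d B',
        reflection_reflection, reflection_inclL d B, map_mul, R.πHat_inclR, R.πHat_inclL, tensorOp_mul,
        flip_tensorOp, map_mul, reflection_inclL d B', R.πHat_inclL, R.πHat_inclR, tensorOp_mul,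
        one_mul, mul_one])
  have hΩ : flip H R.Ω = κ • R.Ω := by
    rw [← hκ R.Ω]
    change _ = flip H (R.Γ R.Ω)
    rw [R.Γ_Ω]
  refine ⟨κ, ?_, hΩ⟩
  have h := flip_flip R.Ω
  rw [hΩ, map_smul, hΩ, smul_smul] at h
  have h0 : R.Ω ≠ 0 := norm_ne_zero_iff.mp (by rw [R.norm_Ω]; exact one_ne_zero)
  exact mul_self_eq_one_iff.mp (smul_left_injective ℂ h0 (h.trans (one_smul ℂ _).symm))

end Flip

section CornerTensor

variable {H : Type*} [NormedAddCommGroup H] [InnerProductSpace ℂ H] {s : H →L[ℂ] H}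

/-- The tensor product of vectors of `sH`, as a bounded bilinear map into `(s ⊗ s)(H ⊗ H)`. -/
def cornerTmul (s : H →L[ℂ] H) : projSpace s →L[ℂ] projSpace s →L[ℂ] cornerSpace s :=
  (ContinuousLinearMap.compL ℂ (projSpace s) (HilbertTensor H H) (cornerSpace s)
    (cornerSpace s).orthogonalProjectionOnto).comp
    ((tmulL H H).bilinearComp (projSpace s).subtypeL (projSpace s).subtypeL)

theorem cornerTmul_apply (a b : projSpace s) :
    cornerTmul s a b = (cornerSpace s).orthogonalProjectionOnto (tmulL H H a b) := rfl

theorem coe_cornerTmul (a b : projSpace s) :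
    (cornerTmul s a b : HilbertTensor H H) = tmulL H H a b := by
  have h : tmulL H H (a : H) b ∈ cornerSpace s := by
    rw [mem_projSpace, tensorOp_tmulL, mem_projSpace.mp a.2, mem_projSpace.mp b.2]
  exact Submodule.starProjection_eq_self_iff.mpr h

theorem inner_cornerTmul_cornerVector (Ω : HilbertTensor H H) (a b : projSpace s) :
    ⟪cornerTmul s a b, cornerVector s Ω⟫_ℂ = ⟪tmulL H H (a : H) b, Ω⟫_ℂ := by
  rw [cornerVector, Submodule.inner_orthogonalProjectionOnto_eq_of_mem_left, coe_cornerTmul]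

variable [CompleteSpace H]

theorem isHilbertTensorProduct_cornerTmul (hs : IsStarProjection s) :
    IsHilbertTensorProduct (cornerTmul s) where
  inner_apply a b a' b' := by
    rw [Submodule.coe_inner, coe_cornerTmul, coe_cornerTmul,
      isHilbertTensorProduct_tmulL.inner_apply]
    rfl
  dense_span := by
    rw [Submodule.dense_iff_topologicalClosure_eq_top, Submodule.topologicalClosure_eq_top_iff,
      eq_bot_iff]
    intro w hw
    rw [Submodule.mem_bot]
    refine Subtype.ext (isHilbertTensorProduct_tmulL.eq_of_inner fun ξ η => ?_)
    have hmem : ∀ v, s v ∈ projSpace s := fun v =>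
      mem_projSpace.mpr (DFunLike.congr_fun hs.isIdempotentElem v)
    have h := (Submodule.mem_orthogonal _ _).mp hw _
      (Submodule.subset_span ⟨(⟨s ξ, hmem ξ⟩, ⟨s η, hmem η⟩), rfl⟩)
    rw [Submodule.coe_inner, coe_cornerTmul] at h
    rw [← mem_projSpace.mp w.2, inner_tmulL_tensorOp, hs.isSelfAdjoint.star_eq,
      Submodule.coe_zero, inner_zero_right]
    exact h

theorem extendOp_coe (x : projSpace s →L[ℂ] projSpace s) (a : projSpace s) :
    extendOp s x a = x a := by
  simp [extendOp]

theorem cornerRight_cornerTmul (x : projSpace s →L[ℂ] projSpace s) (a b : projSpace s) :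
    cornerRight s x (cornerTmul s a b) = cornerTmul s a (x b) := by
  change (cornerSpace s).orthogonalProjectionOnto
    (tensorOp s (extendOp s x) (cornerTmul s a b : HilbertTensor H H)) = _
  rw [coe_cornerTmul, tensorOp_tmulL, extendOp_coe, mem_projSpace.mp a.2, cornerTmul_apply]

theorem cornerLeft_cornerTmul (x : projSpace s →L[ℂ] projSpace s) (a b : projSpace s) :
    cornerLeft s x (cornerTmul s a b) = cornerTmul s (x a) b := by
  change (cornerSpace s).orthogonalProjectionOnto
    (tensorOp (extendOp s x) s (cornerTmul s a b : HilbertTensor H H)) = _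
  rw [coe_cornerTmul, tensorOp_tmulL, extendOp_coe, mem_projSpace.mp b.2, cornerTmul_apply]

theorem cornerLeft_injective (hs : IsStarProjection s) : Function.Injective (cornerLeft s) := by
  intro x y hxy
  ext1 a
  by_contra hne
  have h0 : x a - y a ≠ 0 := sub_ne_zero.mpr hne
  have h := DFunLike.congr_fun hxy (cornerTmul s a (x a - y a))
  rw [cornerLeft_cornerTmul, cornerLeft_cornerTmul, ← sub_eq_zero, ← sub_apply, ← map_sub,
    ← norm_eq_zero, (isHilbertTensorProduct_cornerTmul hs).norm_apply] at h
  exact h0 (norm_eq_zero.mp (mul_self_eq_zero.mp h))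

end CornerTensor

section Support

variable {H : Type*} [NormedAddCommGroup H] [InnerProductSpace ℂ H] [CompleteSpace H]
  {s : H →L[ℂ] H} {Ω : HilbertTensor H H}

/-- No nonzero vector of the support of `Ω` is annihilated by `Ω`. -/
theorem IsSupportProjection.eq_zero_of_inner_eq_zero (hs : IsStarProjection s)
    (hsupp : IsSupportProjection (rightFactor H) Ω (tensorOp 1 s)) (a : projSpace s)
    (ha : ∀ ξ, ⟪tmulL H H ξ (a : H), Ω⟫_ℂ = 0) : a = 0 := by
  by_contra hne
  have hna : ‖(a : H)‖ ≠ 0 := norm_ne_zero_iff.mpr fun h => hne (Subtype.ext h)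
  let u : H := ((‖(a : H)‖ : ℂ)⁻¹) • (a : H)
  have hu : ‖u‖ = 1 := by simp [u, norm_smul, hna]
  have hsu : s u = u := by simp only [u, map_smul, mem_projSpace.mp a.2]
  let P : H →L[ℂ] H := InnerProductSpace.rankOne ℂ u u
  have hP : IsStarProjection P := InnerProductSpace.isStarProjection_rankOne_self hu
  have hsP : s * P = P := by
    ext v
    change s (⟪u, v⟫_ℂ • u) = ⟪u, v⟫_ℂ • u
    rw [map_smul, hsu]
  have hPs : P * s = P := by
    have := congrArg star hsP
    rwa [star_mul, hP.isSelfAdjoint.star_eq, hs.isSelfAdjoint.star_eq] at this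
  have hq : IsStarProjection (s - P) :=
    { isIdempotentElem := by
        rw [IsIdempotentElem, sub_mul, mul_sub, mul_sub, hs.isIdempotentElem.eq,
          hP.isIdempotentElem.eq, hsP, hPs, sub_self, sub_zero]
      isSelfAdjoint := hs.isSelfAdjoint.sub hP.isSelfAdjoint }
  have hPΩ : tensorOp 1 P Ω = 0 := by
    refine isHilbertTensorProduct_tmulL.eq_of_inner fun ξ η => ?_
    rw [inner_tmulL_tensorOp, hP.isSelfAdjoint.star_eq, star_one, one_apply_eq_self,
      inner_zero_right]
    change ⟪tmulL H H ξ (⟪u, η⟫_ℂ • (‖(a : H)‖ : ℂ)⁻¹ • (a : H)), Ω⟫_ℂ = 0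
    rw [smul_smul, map_smul, inner_smul_left, ha, mul_zero]
  have hsub : tensorOp 1 (s - P) = tensorOp 1 s - tensorOp (1 : H →L[ℂ] H) P :=
    map_sub (rightEmbed H) s P
  have hstar : IsStarProjection (tensorOp (1 : H →L[ℂ] H) (s - P)) := hq.map (rightEmbed H)
  have hle : tensorOp 1 s ≤ tensorOp (1 : H →L[ℂ] H) (s - P) := hsupp.2 ⟨⟨s - P, rfl⟩, hstar, by
    change tensorOp 1 (s - P) Ω = Ω
    rw [hsub, sub_apply, hPΩ, sub_zero, hsupp.1.2.2]⟩
  have hpos := (ContinuousLinearMap.le_def _ _).mp hle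
  have hre := hpos.re_inner_nonneg_right (tmulL H H u u)
  have hPu : P u = u := by
    change ⟪u, u⟫_ℂ • u = u
    rw [inner_self_eq_norm_sq_to_K, hu]
    simp
  rw [hsub, sub_sub_cancel_left, neg_apply, tensorOp_tmulL, hPu, one_apply_eq_self,
    inner_neg_right, isHilbertTensorProduct_tmulL.inner_apply, inner_self_eq_norm_sq_to_K, hu] at hre
  norm_num at hre

end Support

section AntiConj

variable {K : Type*} [NormedAddCommGroup K] [InnerProductSpace ℂ K]

/-- An antiunitary is determined up to a phase by its adjoint action. -/
theorem exists_phase_of_antiConj_eq {θ θ' : K ≃ₗᵢ⋆[ℂ] K}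
    (h : ∀ x, antiConj θ' x = antiConj θ x) :
    ∃ c : ℂ, c * (starRingEnd ℂ) c = 1 ∧ ∀ v, θ' v = c • θ v := by
  rcases subsingleton_or_nontrivial K with hK | hK
  · exact ⟨1, by simp, fun v => Subsingleton.elim _ _⟩
  obtain ⟨e, he⟩ := exists_norm_eq K zero_le_one
  have hee : ⟪e, e⟫_ℂ = 1 := by rw [inner_self_eq_norm_sq_to_K, he]; simp
  have hv : ∀ v, θ' v = (starRingEnd ℂ) ⟪e, θ.symm (θ' e)⟫_ℂ • θ v := by
    intro v
    have h1 := DFunLike.congr_fun (h (InnerProductSpace.rankOne ℂ v e)) (θ' e)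
    rw [antiConj_apply, antiConj_apply, LinearIsometryEquiv.symm_apply_apply,
      InnerProductSpace.rankOne_apply, InnerProductSpace.rankOne_apply, hee, one_smul,
      LinearIsometryEquiv.map_smulₛₗ] at h1
    exact h1
  refine ⟨_, ?_, hv⟩
  have h2 := congrArg norm (hv e)
  rw [norm_smul, θ.norm_map, θ'.norm_map, he, mul_one] at h2
  rw [Complex.mul_conj, Complex.normSq_eq_norm_sq, ← h2]
  simp

end AntiConj

section Conjugation

variable {H : Type*} [NormedAddCommGroup H] [InnerProductSpace ℂ H] {s : H →L[ℂ] H} {κ : ℂ} {J : cornerSpace s ≃ₗᵢ⋆[ℂ] cornerSpace s}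
  {θ : projSpace s ≃ₗᵢ⋆[ℂ] projSpace s}

theorem apply_smul_cornerTmul (hκ : κ = 1 ∨ κ = -1)
    (hJ : ∀ a b, J (cornerTmul s a b) = κ • cornerTmul s (θ b) (θ a)) (a b : projSpace s) :
    J (κ • cornerTmul s b a) = cornerTmul s (θ a) (θ b) := by
  rw [LinearIsometryEquiv.map_smulₛₗ, hJ, conj_sign hκ, smul_smul, sign_mul_self hκ, one_smul]

theorem symm_apply_cornerTmul (hκ : κ = 1 ∨ κ = -1)
    (hJ : ∀ a b, J (cornerTmul s a b) = κ • cornerTmul s (θ b) (θ a)) (a b : projSpace s) :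
    J.symm (cornerTmul s (θ a) (θ b)) = κ • cornerTmul s b a := by
  rw [LinearIsometryEquiv.symm_apply_eq, apply_smul_cornerTmul hκ hJ]

variable [CompleteSpace H]

theorem antiConj_cornerRight (hs : IsStarProjection s) (hκ : κ = 1 ∨ κ = -1)
    (hJ : ∀ a b, J (cornerTmul s a b) = κ • cornerTmul s (θ b) (θ a))
    (x : projSpace s →L[ℂ] projSpace s) :
    antiConj J (cornerRight s x) = cornerLeft s (antiConj θ x) := by
  refine (isHilbertTensorProduct_cornerTmul hs).ext fun a b => ?_
  obtain ⟨a, rfl⟩ := θ.surjective a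
  obtain ⟨b, rfl⟩ := θ.surjective b
  rw [antiConj_apply, symm_apply_cornerTmul hκ hJ, map_smul, cornerRight_cornerTmul,
    apply_smul_cornerTmul hκ hJ, cornerLeft_cornerTmul, antiConj_apply,
    LinearIsometryEquiv.symm_apply_apply]

theorem antiConj_cornerLeft (hs : IsStarProjection s) (hκ : κ = 1 ∨ κ = -1)
    (hJ : ∀ a b, J (cornerTmul s a b) = κ • cornerTmul s (θ b) (θ a))
    (x : projSpace s →L[ℂ] projSpace s) :
    antiConj J (cornerLeft s x) = cornerRight s (antiConj θ x) := by
  refine (isHilbertTensorProduct_cornerTmul hs).ext fun a b => ?_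
  obtain ⟨a, rfl⟩ := θ.surjective a
  obtain ⟨b, rfl⟩ := θ.surjective b
  rw [antiConj_apply, symm_apply_cornerTmul hκ hJ, map_smul, cornerLeft_cornerTmul,
    apply_smul_cornerTmul hκ hJ, cornerRight_cornerTmul, antiConj_apply,
    LinearIsometryEquiv.symm_apply_apply]

end Conjugation

end SpinChain

end
open SpinChain in
theorem proposition4p3 (d : ℕ) (hd : 2 ≤ d)
    (ω : AlgZ d →ₗ[ℂ] ℂ) (hpure : IsPureState ω) (hrefl : IsReflectionInvariant ω)
    (hsplit : IsSplit ω)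
    {H : Type*} [NormedAddCommGroup H] [InnerProductSpace ℂ H] [CompleteSpace H]
    (R : ReflectionSplitRep ω H)
    (s : H →L[ℂ] H) (hs : IsStarProjection s)
    (hsupp : IsSupportProjection (rightFactor H) R.Ω (tensorOp 1 s))
    (J : cornerSpace s ≃ₗᵢ⋆[ℂ] cornerSpace s)
    (hJ : IsModularConjugation (cornerAlgebra hs) (cornerVector s R.Ω) J) :
    (∃ θ : projSpace s ≃ₗᵢ⋆[ℂ] projSpace s,
      ∀ x : projSpace s →L[ℂ] projSpace s,
        antiConj J (cornerRight s x) = cornerLeft s (antiConj θ x)) ∧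
    (∀ θ : projSpace s ≃ₗᵢ⋆[ℂ] projSpace s,
      (∀ x : projSpace s →L[ℂ] projSpace s,
        antiConj J (cornerRight s x) = cornerLeft s (antiConj θ x)) →
      ∀ x : projSpace s →L[ℂ] projSpace s,
        antiConj J (cornerLeft s x) = cornerRight s (antiConj θ x)) ∧
    (∃ κ : ℂ, (κ = 1 ∨ κ = -1) ∧
      ∀ θ : projSpace s ≃ₗᵢ⋆[ℂ] projSpace s,
        (∀ x : projSpace s →L[ℂ] projSpace s,
          antiConj J (cornerRight s x) = cornerLeft s (antiConj θ x)) →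
        ∀ v : projSpace s, θ (θ v) = κ • v) := by
  obtain ⟨κ, hκ, hflip⟩ := R.exists_flip_eq
  have hm := isHilbertTensorProduct_cornerTmul hs
  have hsΩ : tensorOp 1 s R.Ω = R.Ω := hsupp.1.2.2
  have hflip' : ∀ ξ η, inner ℂ (tmulL H H ξ η) R.Ω = κ * inner ℂ (tmulL H H η ξ) R.Ω :=
    fun ξ η => by rw [← inner_smul_right, ← hflip, inner_tmulL_flip]
  have hsym : ∀ a b, inner ℂ (cornerTmul s a b) (cornerVector s R.Ω) =
      κ * inner ℂ (cornerTmul s b a) (cornerVector s R.Ω) := fun a b => by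
    rw [inner_cornerTmul_cornerVector, inner_cornerTmul_cornerVector, hflip']
  have hinj : ∀ a, contraction (cornerTmul s) (cornerVector s R.Ω) a = 0 → a = 0 := by
    intro a ha
    refine hsupp.eq_zero_of_inner_eq_zero hs a fun ξ => ?_
    have hξ : s ξ ∈ projSpace s :=
      mem_projSpace.mpr (DFunLike.congr_fun hs.isIdempotentElem ξ)
    have h1 := inner_contraction (cornerTmul s) (cornerVector s R.Ω) a ⟨s ξ, hξ⟩
    rw [ha, inner_zero_right, inner_cornerTmul_cornerVector] at h1
    rw [hflip', ← hsΩ, inner_tmulL_tensorOp, hs.isSelfAdjoint.star_eq, star_one,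
      one_apply_eq_self]
    exact mul_eq_zero_of_right κ h1.symm
  have : Nontrivial (projSpace s) := by
    by_contra hcon
    rw [not_nontrivial_iff_subsingleton] at hcon
    have h0 : s = 0 := by
      ext v
      have hv : s v ∈ projSpace s := mem_projSpace.mpr (DFunLike.congr_fun hs.isIdempotentElem v)
      exact congrArg Subtype.val (Subsingleton.elim (⟨s v, hv⟩ : projSpace s) 0)
    have h1 : tensorOp (1 : H →L[ℂ] H) s = 0 := by rw [h0]; exact map_zero (rightEmbed H)
    have h2 := R.norm_Ω
    rw [← hsΩ, h1] at h2
    simp at h2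
  obtain ⟨θ, hθ, hJθ⟩ := exists_antiunitary_modularConjugation (R := cornerHom hs) hm hκ
    (fun x a b => cornerRight_cornerTmul x a b) hsym hinj hJ
  have huniq : ∀ θ' : projSpace s ≃ₗᵢ⋆[ℂ] projSpace s,
      (∀ x, antiConj J (cornerRight s x) = cornerLeft s (antiConj θ' x)) →
      ∀ x, antiConj θ' x = antiConj θ x := fun θ' h x =>
    cornerLeft_injective hs ((h x).symm.trans (antiConj_cornerRight hs hκ hJθ x))
  refine ⟨⟨θ, antiConj_cornerRight hs hκ hJθ⟩, fun θ' h x => ?_, κ, hκ, fun θ' h v => ?_⟩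
  · rw [huniq θ' h, antiConj_cornerLeft hs hκ hJθ]
  · obtain ⟨c, hc, hcv⟩ := exists_phase_of_antiConj_eq (huniq θ' h)
    rw [hcv, hcv, LinearIsometryEquiv.map_smulₛₗ, hθ, smul_smul, hc, one_smul]
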